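/- Let $\mathrm{SU}(2)$ carry its normalised Haar measure $\mathrm{d}\mu$ and the left-invariant vector fields $Z_1,Z_2,Z_3$ generated by $-\tfrac{i}{2}\sigma_k$ ($\sigma_k$ the Pauli matrices), so that $[Z_i,Z_j]=\epsilon_{ijk}Z_k$; put $X_\pm=-(Z_2\pm iZ_1)$ and $Z^\alpha=Z_1^{\alpha_1}Z_2^{\alpha_2}Z_3^{\alpha_3}$ for $\alpha\in\mathbb{N}^3$. For $0<\varepsilon<2$ and $\rho_\star>0$ consider, in coordinates $(\tau,\rho,g)\in\mathbb{R}\times\mathbb{R}\times\mathrm{SU}(2)$, the lower domain, the portion of past null infinity and the short incoming null hypersurface \[ \underline{\mathcal N}_\varepsilon=\Big\{-1\le\tau\le-1+\varepsilon,\ 0\le\rho\le\tfrac{2\rho_\star}{1-\tau}\Big\},\quad \mathscr I^-_{\rho_\star}=\{\tau=-1,\ 0\le\rho\le\rho_\star\},\quad \underline{\mathcal B}_\varepsilon=\Big\{-1\le\tau\le-1+\varepsilon,\ \rho=\tfrac{2\rho_\star}{1-\tau}\Big\}. \] Let $\mathrm{dv}=\mathrm{d}\tau\,\mathrm{d}\rho\,\mathrm{d}\mu$,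 and let $\mathrm{d}\underline{\mathcal B}=\frac{\sqrt2\,\rho}{1-\tau}\,\mathrm{d}\tau\,\mathrm{d}\mu$ be the measure induced on $\underline{\mathcal B}_\varepsilon$ by contracting $\mathrm{dv}$ with $\frac1{\sqrt2}\big((1+\tau)\partial_\tau-\rho\,\partial_\rho\big)$. Write $D'=\partial_\rho^{p'}\partial_\tau^{q'}Z^\alpha$, let $\sum_\mho$ denote the sum over all $(q',p',\alpha)\in\mathbb{N}\times\mathbb{N}\times\mathbb{N}^3$ with $q'+p'+|\alpha|\le m$, and set $\|f\|^2_{H^m(\underline{\mathcal N}_\varepsilon)}=\sum_\mho\int_{\underline{\mathcal N}_\varepsilon}|D'f|^2\,\mathrm{dv}$. Let $m,p,q\in\mathbb{N}$ (zero allowed) with $m+p<q$. Then there is a constant $C>0$, depending only on $m$, $p$ and $q$ (in particular independent of $\varepsilon$ and $\rho_\star$), such that the following holds for all $0<\varepsilon<2$, $\rho_\star>0$ and $\Omega_\star>0$. Let $\psi,\psi_0,\psi_1,\psi_2$ be complex-valued functions of class $C^{m+p+q+1}$ on $\underline{\mathcal N}_\varepsilon$, up to its boundary, which satisfy there the transport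 system \begin{align*} (1+\tau)\partial_\tau\psi_2-\rho\,\partial_\rho\psi_2-\tfrac12X_-\psi-X_-\psi_1&=0,\\ (1-\tau)\partial_\tau\psi_1+\rho\,\partial_\rho\psi_1+\tfrac12\big((1-\tau)\partial_\tau\psi+\rho\,\partial_\rho\psi\big)-X_+\psi_2-\tfrac12\psi-\psi_1&=0,\\ (1+\tau)\partial_\tau\psi_1-\rho\,\partial_\rho\psi_1-\tfrac12\big((1+\tau)\partial_\tau\psi-\rho\,\partial_\rho\psi\big)-X_-\psi_0-\tfrac12\psi+\psi_1&=0,\\ (1-\tau)\partial_\tau\psi_0+\rho\,\partial_\rho\psi_0+\tfrac12X_+\psi-X_+\psi_1&=0. \end{align*} Suppose that for each $f\in\{\psi,\psi_0,\psi_1,\psi_2\}$ the characteristic data satisfy \[ \sum_\mho\int_{\mathscr I^-_{\rho_\star}}|D'(\partial_\tau^q\partial_\rho^pf)|^2\,\mathrm{d}\rho\,\mathrm{d}\mu+\sum_\mho\int_{\underline{\mathcal B}_\varepsilon}|D'(\partial_\tau^q\partial_\rho^pf)|^2\,\mathrm{d}\underline{\mathcal B}\le\Omega_\star , \] and that $\|\partial_\rho^p\partial_\tau^qg\|^2_{H^m(\underline{\mathcal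 N}_\varepsilon)}\le\Omega_\star$ for each $g\in\{\psi,\psi_0,\psi_1\}$. Then \[ \|\partial_\rho^p\partial_\tau^q\psi_2\|^2_{H^m(\underline{\mathcal N}_\varepsilon)}\le C\,\Omega_\star . \] -/

import Mathlib

open MeasureTheory Set

namespace LowerDomain

noncomputable section

/-! ### The group `SU(2)`, its Haar measure and its left-invariant frame -/

/-- The group `SU(2)`. -/
abbrev SU2 : Type := Matrix.specialUnitaryGroup (Fin 2) ℂ

instance instTopologicalGroupSU2 : IsTopologicalGroup SU2 where
  continuous_inv :=
    (continuous_star.comp continuous_subtype_val).subtype_mk _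

instance instCompactSpaceSU2 : CompactSpace SU2 := by
  have hK : IsCompact (Set.univ.pi fun _ : Fin 2 => Set.univ.pi fun _ : Fin 2 =>
      Metric.closedBall (0 : ℂ) 1) :=
    isCompact_univ_pi fun _ => isCompact_univ_pi fun _ => isCompact_closedBall 0 1
  have hclosed : IsClosed {A : Matrix (Fin 2) (Fin 2) ℂ |
      (star A * A = 1 ∧ A * star A = 1) ∧ A.det = 1} := by
    refine IsClosed.and (IsClosed.and ?_ ?_) ?_
    · exact isClosed_eq (continuous_star.mul continuous_id) continuous_const
    · exact isClosed_eq (continuous_id.mul continuous_star) continuous_const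
    · exact isClosed_eq continuous_id.matrix_det continuous_const
  refine isCompact_iff_compactSpace.mp (hK.of_isClosed_subset hclosed ?_)
  intro A hA i _ j _
  have hU : A ∈ Matrix.unitaryGroup (Fin 2) ℂ := hA.1
  simpa using entry_norm_bound_of_unitary hU i j

instance instMeasurableSpaceSU2 : MeasurableSpace SU2 := borel SU2

instance instBorelSpaceSU2 : BorelSpace SU2 := ⟨rfl⟩

/-- The normalised Haar measure `dμ` on `SU(2)`. -/
def haarSU2 : Measure SU2 := Measure.haarMeasure ⊤

/-- The matrices `-i σₖ`, where `σ₁, σ₂, σ₃` (indices `0, 1, 2`) are the Pauli matrices. -/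
def pauliJ : Fin 3 → Matrix (Fin 2) (Fin 2) ℂ :=
  ![!![0, -Complex.I; -Complex.I, 0], !![0, -1; 1, 0], !![-Complex.I, 0; 0, Complex.I]]

/-- The basis `ξₖ = -(i/2) σₖ` of the Lie algebra `su(2)`. -/
def su2Basis (k : Fin 3) : Matrix (Fin 2) (Fin 2) ℂ := (1 / 2 : ℝ) • pauliJ k

/-- The normalisation of the basis: `[ξ₁, ξ₂] = ξ₃` and cyclic permutations. -/
theorem su2Basis_commutator (k : Fin 3) :
    su2Basis k * su2Basis (k + 1) - su2Basis (k + 1) * su2Basis k = su2Basis (k + 2) := by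
  fin_cases k <;> ext i j <;> fin_cases i <;> fin_cases j <;>
    simp [su2Basis, pauliJ] <;> ring_nf <;>
    simp [Complex.I_sq] <;> norm_num

theorem pauliJ_sq (k : Fin 3) : pauliJ k * pauliJ k = -1 := by
  fin_cases k <;> ext i j <;> fin_cases i <;> fin_cases j <;>
    simp [pauliJ, Matrix.mul_apply, Fin.sum_univ_two]

theorem exp_su2Basis (k : Fin 3) (t : ℝ) :
    NormedSpace.exp (t • su2Basis k)
      = algebraMap ℝ (Matrix (Fin 2) (Fin 2) ℂ) (Real.cos (t / 2))
        + Real.sin (t / 2) • pauliJ k := by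
  let L := Complex.liftAux (pauliJ k) (pauliJ_sq k)
  have hL : Continuous L := by
    have h : (fun z : ℂ => L z) = fun z : ℂ =>
        algebraMap ℝ (Matrix (Fin 2) (Fin 2) ℂ) z.re + z.im • pauliJ k := by
      funext z
      exact Complex.liftAux_apply _ _ z
    change Continuous (fun z : ℂ => L z)
    rw [h]
    refine Continuous.add ?_ ?_
    · exact (continuous_algebraMap ℝ (Matrix (Fin 2) (Fin 2) ℂ)).comp Complex.continuous_re
    · exact Complex.continuous_im.smul continuous_const
  have h1 : L (((t / 2 : ℝ) : ℂ) * Complex.I) = t • su2Basis k := by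
    change Complex.liftAux _ _ _ = _
    rw [Complex.liftAux_apply]
    simp [su2Basis, smul_smul, div_eq_mul_inv]
  have h2 : L (NormedSpace.exp (((t / 2 : ℝ) : ℂ) * Complex.I))
      = NormedSpace.exp (L (((t / 2 : ℝ) : ℂ) * Complex.I)) := by
    let _ : NormedRing (Matrix (Fin 2) (Fin 2) ℂ) := Matrix.linftyOpNormedRing
    let _ : NormedAlgebra ℂ (Matrix (Fin 2) (Fin 2) ℂ) := Matrix.linftyOpNormedAlgebra
    exact NormedSpace.map_exp L hL _
  rw [← h1, ← h2, ← Complex.exp_eq_exp_ℂ]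
  change Complex.liftAux _ _ _ = _
  rw [Complex.liftAux_apply, Complex.exp_ofReal_mul_I_re, Complex.exp_ofReal_mul_I_im]

theorem exp_su2Basis_mem (k : Fin 3) (t : ℝ) :
    NormedSpace.exp (t • su2Basis k) ∈ Matrix.specialUnitaryGroup (Fin 2) ℂ := by
  have h : (Real.cos (t / 2) : ℂ) ^ 2 + (Real.sin (t / 2) : ℂ) ^ 2 = 1 := by
    exact_mod_cast Real.cos_sq_add_sin_sq (t / 2)
  rw [exp_su2Basis, Matrix.mem_specialUnitaryGroup_iff, Matrix.mem_unitaryGroup_iff]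
  set c := Real.cos (t / 2)
  set s := Real.sin (t / 2)
  have hI : Complex.I ^ 2 = -1 := Complex.I_sq
  constructor
  · fin_cases k <;> ext i j <;> fin_cases i <;> fin_cases j <;>
      simp [pauliJ, Matrix.mul_apply, Fin.sum_univ_two, Matrix.algebraMap_eq_diagonal,
        Matrix.star_eq_conjTranspose] <;>
      first
        | ring1
        | linear_combination h
        | linear_combination h - (s : ℂ) ^ 2 * hI
  · fin_cases k <;> simp [pauliJ, Matrix.det_fin_two, Matrix.algebraMap_eq_diagonal] <;>
      first
        | linear_combination h
        | linear_combination h - (s : ℂ) ^ 2 * hI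

/-- The one-parameter subgroup `t ↦ exp (t ξₖ)` of `SU(2)`. -/
def oneParam (k : Fin 3) (t : ℝ) : SU2 :=
  ⟨NormedSpace.exp (t • su2Basis k), exp_su2Basis_mem k t⟩

/-- The matrix with rows `(a, -b̄)` and `(b, ā)`, divided by `(|a|² + |b|²)^{1/2}`. -/
def normalizedMatrix (v : ℂ × ℂ) : Matrix (Fin 2) (Fin 2) ℂ :=
  (Real.sqrt (Complex.normSq v.1 + Complex.normSq v.2))⁻¹ •
    !![v.1, -(starRingEnd ℂ v.2); v.2, starRingEnd ℂ v.1]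

theorem normalizedMatrix_mem {v : ℂ × ℂ} (hv : v ≠ 0) :
    normalizedMatrix v ∈ Matrix.specialUnitaryGroup (Fin 2) ℂ := by
  obtain ⟨a, b⟩ := v
  have hpos : 0 < Complex.normSq a + Complex.normSq b := by
    by_cases ha : a = 0
    · have hb : b ≠ 0 := fun hb => hv (by rw [ha, hb]; rfl)
      exact add_pos_of_nonneg_of_pos (Complex.normSq_nonneg a) (Complex.normSq_pos.mpr hb)
    · exact add_pos_of_pos_of_nonneg (Complex.normSq_pos.mpr ha) (Complex.normSq_nonneg b)
  set n : ℝ := (Real.sqrt (Complex.normSq a + Complex.normSq b))⁻¹ with hn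
  have h1 : n ^ 2 * (Complex.normSq a + Complex.normSq b) = 1 := by
    rw [hn, inv_pow, Real.sq_sqrt hpos.le, inv_mul_cancel₀ hpos.ne']
  have h2 : (n : ℂ) ^ 2 * (a * starRingEnd ℂ a + b * starRingEnd ℂ b) = 1 := by
    rw [Complex.mul_conj, Complex.mul_conj]
    exact_mod_cast h1
  rw [Matrix.mem_specialUnitaryGroup_iff, Matrix.mem_unitaryGroup_iff]
  change normalizedMatrix (a, b) * star (normalizedMatrix (a, b)) = 1 ∧
    (normalizedMatrix (a, b)).det = 1
  constructor
  · ext i j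
    fin_cases i <;> fin_cases j <;>
      simp [normalizedMatrix, ← hn, Matrix.mul_apply, Fin.sum_univ_two,
        Matrix.star_eq_conjTranspose] <;>
      first
        | linear_combination h2
        | ring1
  · simp [normalizedMatrix, ← hn, Matrix.det_fin_two]
    linear_combination h2

open Classical in
/-- The radial projection `ℂ² ∖ {0} → S³ ≅ SU(2)`, sending `v = (a, b)` to the element of `SU(2)`
whose first column is `v / |v|` (and the irrelevant point `v = 0` to the identity). -/
def radialSU2 (v : ℂ × ℂ) : SU2 :=
  if hv : v ≠ 0 then ⟨normalizedMatrix v, normalizedMatrix_mem hv⟩ else 1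

/-! ### Fields on `ℝ_τ × ℝ_ρ × SU(2)` and their derivatives -/

/-- Complex functions of `(τ, ρ)` and of a point of `SU(2)`. -/
abbrev Field : Type := ℝ × ℝ → SU2 → ℂ

/-- `f` is of class `C^n` on `K × SU(2)`, up to the boundary of the region `K` of the
`(τ, ρ)`-plane. Since `radialSU2` is a smooth submersion of `ℂ² ∖ {0}` onto `SU(2)` which admits a
smooth section, a function on `SU(2)` is `C^n` if and only if its composition with `radialSU2` is
`C^n` on `ℂ² ∖ {0}`. -/
def IsCk (n : ℕ) (K : Set (ℝ × ℝ)) (f : Field) : Prop :=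
  ContDiffOn ℝ n (fun w : (ℝ × ℝ) × (ℂ × ℂ) => f w.1 (radialSU2 w.2)) (K ×ˢ {0}ᶜ)

/-- `∂_τ f` on `K` (one-sided at the boundary of `K`). -/
def dTau (K : Set (ℝ × ℝ)) (f : Field) : Field :=
  fun z g => fderivWithin ℝ (fun w => f w g) K z (1, 0)

/-- `∂_ρ f` on `K` (one-sided at the boundary of `K`). -/
def dRho (K : Set (ℝ × ℝ)) (f : Field) : Field :=
  fun z g => fderivWithin ℝ (fun w => f w g) K z (0, 1)

/-- The left-invariant vector field `Zₖ` on `SU(2)` generated by `ξₖ = -(i/2) σₖ`; these satisfy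
`[Z₁, Z₂] = Z₃` and cyclic permutations. -/
def Z (k : Fin 3) (f : Field) : Field :=
  fun z g => deriv (fun t : ℝ => f z (g * oneParam k t)) 0

/-- `X₊ = -(Z₂ + i Z₁)`. -/
def Xplus (f : Field) : Field := fun z g => -(Z 1 f z g + Complex.I * Z 0 f z g)

/-- `X₋ = -(Z₂ - i Z₁)`. -/
def Xminus (f : Field) : Field := fun z g => -(Z 1 f z g - Complex.I * Z 0 f z g)

/-- `Z^α = Z₁^{α₁} Z₂^{α₂} Z₃^{α₃}`. -/
def Zpow (α : Fin 3 → ℕ) (f : Field) : Field :=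
  (Z 0)^[α 0] ((Z 1)^[α 1] ((Z 2)^[α 2] f))

/-- The operator `D' = ∂_ρ^{p'} ∂_τ^{q'} Z^α`. -/
def D (K : Set (ℝ × ℝ)) (p' q' : ℕ) (α : Fin 3 → ℕ) (f : Field) : Field :=
  (dRho K)^[p'] ((dTau K)^[q'] (Zpow α f))

/-- The finite set of all `(q', p', α) ∈ ℕ × ℕ × ℕ³` with `q' + p' + |α| ≤ m`. -/
def mho (m : ℕ) : Finset (ℕ × ℕ × (Fin 3 → ℕ)) :=
  (Finset.range (m + 1) ×ˢ Finset.range (m + 1) ×ˢ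
    Fintype.piFinset fun _ : Fin 3 => Finset.range (m + 1)).filter
      fun x => x.1 + x.2.1 + ∑ i, x.2.2 i ≤ m

theorem mem_mho {m : ℕ} {x : ℕ × ℕ × (Fin 3 → ℕ)} :
    x ∈ mho m ↔ x.1 + x.2.1 + ∑ i, x.2.2 i ≤ m := by
  simp only [mho, Finset.mem_filter, Finset.mem_product, Finset.mem_range, Fintype.mem_piFinset,
    and_iff_right_iff_imp]
  intro h
  refine ⟨by omega, by omega, fun i => ?_⟩
  have hi := Finset.single_le_sum (f := x.2.2) (fun _ _ => Nat.zero_le _) (Finset.mem_univ i)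
  omega

/-! ### The lower domain and the norms -/

/-- The `ρ`-coordinate `2 ρ⋆ / (1 - τ)` of the incoming null hypersurface at time `τ`. -/
def edge (ρs τ : ℝ) : ℝ := 2 * ρs / (1 - τ)

/-- The `(τ, ρ)`-region of the lower domain:
`-1 ≤ τ ≤ -1 + ε` and `0 ≤ ρ ≤ 2 ρ⋆ / (1 - τ)`. -/
def region (ε ρs : ℝ) : Set (ℝ × ℝ) :=
  {z | -1 ≤ z.1 ∧ z.1 ≤ -1 + ε ∧ 0 ≤ z.2 ∧ z.2 ≤ edge ρs z.1}

/-- The density with respect to `dτ dμ` of the measure `e₁₁' ⌟ (dτ ∧ dρ ∧ dμ)` induced on the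
incoming null hypersurface `ρ = 2 ρ⋆ / (1 - τ)`, where
`e₁₁' = ((1 + τ) ∂_τ - ρ ∂_ρ) / √2`. -/
def edgeDensity (ρs τ : ℝ) : ℝ := Real.sqrt 2 * edge ρs τ / (1 - τ)

/-- Contracting gives `((1 + τ) dρ ∧ dμ + ρ dτ ∧ dμ) / √2`, whose pull-back to the hypersurface
has the density above. -/
theorem edgeDensity_eq (ρs : ℝ) {τ : ℝ} (hτ : τ < 1) :
    edgeDensity ρs τ = ((1 + τ) * deriv (edge ρs) τ + edge ρs τ) / Real.sqrt 2 := by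
  have h1 : 1 - τ ≠ 0 := by linarith
  have hd : HasDerivAt (edge ρs) (2 * ρs / (1 - τ) ^ 2) τ := by
    have h := ((hasDerivAt_id τ).const_sub 1).fun_inv h1
    have h' := h.const_mul (2 * ρs)
    have e1 : edge ρs = fun y => 2 * ρs * (1 - id y)⁻¹ := by
      funext y
      simp only [edge, id, div_eq_mul_inv]
    have e2 : 2 * ρs / (1 - τ) ^ 2 = 2 * ρs * (- -1 / (1 - id τ) ^ 2) := by
      simp only [id]
      ring
    rw [e1, e2]
    exact h'
  have h2 : Real.sqrt 2 * Real.sqrt 2 = 2 := Real.mul_self_sqrt (by norm_num)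
  have h3 : Real.sqrt 2 ≠ 0 := by positivity
  rw [hd.deriv, edgeDensity, edge, eq_div_iff h3]
  field_simp
  linear_combination (ρs) * h2

/-- `‖f‖²_{H^m}` of the lower domain: the sum over `(q', p', α)` with `q' + p' + |α| ≤ m` of the
integrals of `|D' f|²` against `dτ dρ dμ`. -/
def sobolevSq (ε ρs : ℝ) (m : ℕ) (f : Field) : ENNReal :=
  ∑ x ∈ mho m, ∫⁻ z in region ε ρs, ∫⁻ g, ‖D (region ε ρs) x.2.1 x.1 x.2.2 f z g‖ₑ ^ 2 ∂haarSU2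

/-- The sum over `(q', p', α)` with `q' + p' + |α| ≤ m` of the integrals of `|D' f|²` over the
portion `0 ≤ ρ ≤ ρ⋆` of past null infinity `τ = -1`, against `dρ dμ`. -/
def scriDataSq (ε ρs : ℝ) (m : ℕ) (f : Field) : ENNReal :=
  ∑ x ∈ mho m, ∫⁻ ρ in Icc 0 ρs, ∫⁻ g,
    ‖D (region ε ρs) x.2.1 x.1 x.2.2 f (-1, ρ) g‖ₑ ^ 2 ∂haarSU2

/-- The sum over `(q', p', α)` with `q' + p' + |α| ≤ m` of the integrals of `|D' f|²` over the
incoming null hypersurface `ρ = 2 ρ⋆ / (1 - τ)`, `-1 ≤ τ ≤ -1 + ε`, against its induced measure. -/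
def edgeDataSq (ε ρs : ℝ) (m : ℕ) (f : Field) : ENNReal :=
  ∑ x ∈ mho m, ∫⁻ τ in Icc (-1) (-1 + ε), ENNReal.ofReal (edgeDensity ρs τ) *
    ∫⁻ g, ‖D (region ε ρs) x.2.1 x.1 x.2.2 f (τ, edge ρs τ) g‖ₑ ^ 2 ∂haarSU2

/-- The first-order transport system for `ψ, ψ₀, ψ₁, ψ₂` at all points of `K × SU(2)`. -/
structure SolvesTransport (K : Set (ℝ × ℝ)) (ψ ψ₀ ψ₁ ψ₂ : Field) : Prop where
  A₀ : ∀ τ ρ : ℝ, (τ, ρ) ∈ K → ∀ g : SU2,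
    (1 + τ) * dTau K ψ₂ (τ, ρ) g - ρ * dRho K ψ₂ (τ, ρ) g
      - 1 / 2 * Xminus ψ (τ, ρ) g - Xminus ψ₁ (τ, ρ) g = 0
  B₀ : ∀ τ ρ : ℝ, (τ, ρ) ∈ K → ∀ g : SU2,
    (1 - τ) * dTau K ψ₁ (τ, ρ) g + ρ * dRho K ψ₁ (τ, ρ) g
      + 1 / 2 * ((1 - τ) * dTau K ψ (τ, ρ) g + ρ * dRho K ψ (τ, ρ) g)
      - Xplus ψ₂ (τ, ρ) g - 1 / 2 * ψ (τ, ρ) g - ψ₁ (τ, ρ) g = 0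
  A₁ : ∀ τ ρ : ℝ, (τ, ρ) ∈ K → ∀ g : SU2,
    (1 + τ) * dTau K ψ₁ (τ, ρ) g - ρ * dRho K ψ₁ (τ, ρ) g
      - 1 / 2 * ((1 + τ) * dTau K ψ (τ, ρ) g - ρ * dRho K ψ (τ, ρ) g)
      - Xminus ψ₀ (τ, ρ) g - 1 / 2 * ψ (τ, ρ) g + ψ₁ (τ, ρ) g = 0
  B₁ : ∀ τ ρ : ℝ, (τ, ρ) ∈ K → ∀ g : SU2,
    (1 - τ) * dTau K ψ₀ (τ, ρ) g + ρ * dRho K ψ₀ (τ, ρ) g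
      + 1 / 2 * Xplus ψ (τ, ρ) g - Xplus ψ₁ (τ, ρ) g = 0

end

end LowerDomain

open LowerDomain

/-!
With `w = ψ₁ + ψ / 2`, the first two equations read `(1 + τ) ∂_τ ψ₂ - ρ ∂_ρ ψ₂ = X₋ w` and
`(1 - τ) ∂_τ w + ρ ∂_ρ w - w = X₊ ψ₂`. Every `∂_τ` applied to the first one adds `1` to its
coefficient of order zero, and every `∂_ρ` subtracts `1`; hence `m + p < q` makes this coefficient
at least `1` for all the derivatives in the norm. Both null fields are divergence free, and `X₊`
is the negative of the adjoint of `X₋`. Integrating `|ψ₂|²` and `|w|²` along them over the lower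
domain, the angular terms cancel, the boundary terms are bounded by the characteristic data, and
the coefficient of order zero controls the norm of `ψ₂`. The commutators `[Z^α, X_±]` are of order
`|α|`, so they are absorbed by the energies.
-/

namespace LowerDomain

/-! ### The radial projection onto `SU(2)` -/

theorem adjugate_coe (g : SU2) : g.1.adjugate = star g.1 := by
  obtain ⟨hU, hdet⟩ := Matrix.mem_specialUnitaryGroup_iff.mp g.2
  rw [← Matrix.inv_eq_left_inv (Matrix.mem_unitaryGroup_iff'.mp hU), Matrix.inv_def, hdet,
    Ring.inverse_one, one_smul]

theorem apply_one_one (g : SU2) : g.1 1 1 = starRingEnd ℂ (g.1 0 0) := by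
  simpa [Matrix.adjugate_fin_two] using congrFun (congrFun (adjugate_coe g) 0) 0

theorem apply_zero_one (g : SU2) : g.1 0 1 = -starRingEnd ℂ (g.1 1 0) := by
  simpa [Matrix.adjugate_fin_two, neg_eq_iff_eq_neg] using
    congrFun (congrFun (adjugate_coe g) 0) 1

theorem normSq_add_normSq_eq_one (g : SU2) :
    Complex.normSq (g.1 0 0) + Complex.normSq (g.1 1 0) = 1 := by
  have hdet := (Matrix.mem_specialUnitaryGroup_iff.mp g.2).2
  rw [Matrix.det_fin_two, apply_one_one, apply_zero_one, neg_mul, sub_neg_eq_add,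
    Complex.mul_conj, mul_comm, Complex.mul_conj] at hdet
  exact_mod_cast hdet

/-- The first column of a matrix in `SU(2)`, a smooth section of `radialSU2`. -/
def firstCol (g : SU2) : ℂ × ℂ := (g.1 0 0, g.1 1 0)

theorem continuous_firstCol : Continuous firstCol :=
  (continuous_subtype_val.matrix_elem 0 0).prodMk (continuous_subtype_val.matrix_elem 1 0)

theorem firstCol_ne_zero (g : SU2) : firstCol g ≠ 0 := by
  intro h
  have h0 : g.1 0 0 = 0 := congrArg Prod.fst h
  have h1 : g.1 1 0 = 0 := congrArg Prod.snd h
  simpa [h0, h1] using normSq_add_normSq_eq_one g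

@[simp]
theorem radialSU2_firstCol (g : SU2) : radialSU2 (firstCol g) = g := by
  rw [radialSU2, dif_pos (firstCol_ne_zero g)]
  apply Subtype.ext
  change normalizedMatrix (g.1 0 0, g.1 1 0) = g.1
  simp only [normalizedMatrix, normSq_add_normSq_eq_one, Real.sqrt_one, inv_one, one_smul]
  ext i j
  fin_cases i <;> fin_cases j <;> simp [apply_one_one, apply_zero_one]

/-- Right multiplication by `P` on `ℂ²`, identified with the real span of `SU(2)` by
`v ↦ !![v.1, -v̄.2; v.2, v̄.1]`: the first column of the product of this matrix with `P`. -/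
noncomputable def colMul (P : Matrix (Fin 2) (Fin 2) ℂ) : (ℂ × ℂ) →L[ℝ] (ℂ × ℂ) :=
  LinearMap.toContinuousLinearMap
    { toFun := fun v => (v.1 * P 0 0 - starRingEnd ℂ v.2 * P 1 0,
        v.2 * P 0 0 + starRingEnd ℂ v.1 * P 1 0)
      map_add' := fun v w => by
        ext <;> simp <;> ring
      map_smul' := fun c v => by
        ext <;> simp <;> ring }

theorem colMul_apply (P : Matrix (Fin 2) (Fin 2) ℂ) (v : ℂ × ℂ) :
    colMul P v = (v.1 * P 0 0 - starRingEnd ℂ v.2 * P 1 0,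
        v.2 * P 0 0 + starRingEnd ℂ v.1 * P 1 0) := rfl

theorem normSq_colMul (P : Matrix (Fin 2) (Fin 2) ℂ) (v : ℂ × ℂ) :
    Complex.normSq (colMul P v).1 + Complex.normSq (colMul P v).2
      = (Complex.normSq v.1 + Complex.normSq v.2)
        * (Complex.normSq (P 0 0) + Complex.normSq (P 1 0)) := by
  simp only [colMul_apply, Complex.normSq_apply, Complex.add_re, Complex.add_im, Complex.sub_re,
    Complex.sub_im, Complex.mul_re, Complex.mul_im, Complex.conj_re, Complex.conj_im]
  ring

theorem normSq_add_normSq_eq_zero {v : ℂ × ℂ} :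
    Complex.normSq v.1 + Complex.normSq v.2 = 0 ↔ v = 0 := by
  rw [add_eq_zero_iff_of_nonneg (Complex.normSq_nonneg _) (Complex.normSq_nonneg _),
    Complex.normSq_eq_zero, Complex.normSq_eq_zero, Prod.ext_iff, Prod.fst_zero, Prod.snd_zero]

theorem colMul_ne_zero (e : SU2) {v : ℂ × ℂ} (hv : v ≠ 0) : colMul e.1 v ≠ 0 := by
  rwa [Ne, ← normSq_add_normSq_eq_zero, normSq_colMul, normSq_add_normSq_eq_one, mul_one,
    normSq_add_normSq_eq_zero]

theorem radialSU2_mul (e : SU2) {v : ℂ × ℂ} (hv : v ≠ 0) :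
    radialSU2 v * e = radialSU2 (colMul e.1 v) := by
  rw [radialSU2, dif_pos hv, radialSU2, dif_pos (colMul_ne_zero e hv)]
  apply Subtype.ext
  change normalizedMatrix v * e.1 = normalizedMatrix (colMul e.1 v)
  rw [normalizedMatrix, normalizedMatrix, normSq_colMul, normSq_add_normSq_eq_one, mul_one,
    Matrix.smul_mul, colMul_apply]
  congr 1
  ext i j
  fin_cases i <;> fin_cases j <;>
    simp [apply_one_one, apply_zero_one, Matrix.mul_apply, Fin.sum_univ_two] <;> ring

theorem oneParam_zero (k : Fin 3) : oneParam k 0 = 1 := by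
  apply Subtype.ext
  change NormedSpace.exp ((0 : ℝ) • su2Basis k) = 1
  simp

theorem oneParam_add (k : Fin 3) (s t : ℝ) : oneParam k (s + t) = oneParam k s * oneParam k t := by
  apply Subtype.ext
  change NormedSpace.exp ((s + t) • su2Basis k)
    = NormedSpace.exp (s • su2Basis k) * NormedSpace.exp (t • su2Basis k)
  rw [add_smul]
  exact Matrix.exp_add_of_commute _ _ (((Commute.refl _).smul_left s).smul_right t)

theorem colMul_oneParam (k : Fin 3) (t : ℝ) (v : ℂ × ℂ) :
    colMul (oneParam k t).1 v
      = Real.cos (t / 2) • v + Real.sin (t / 2) • colMul (pauliJ k) v := by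
  change colMul (NormedSpace.exp (t • su2Basis k)) v = _
  rw [exp_su2Basis]
  simp only [colMul_apply]
  ext <;> simp [Matrix.algebraMap_eq_diagonal] <;> ring

theorem hasDerivAt_colMul_oneParam (k : Fin 3) (v : ℂ × ℂ) :
    HasDerivAt (fun t : ℝ => colMul (oneParam k t).1 v) (colMul (su2Basis k) v) 0 := by
  have hhalf : HasDerivAt (fun t : ℝ => t / 2) (1 / 2) 0 := (hasDerivAt_id (0 : ℝ)).div_const 2
  simp only [colMul_oneParam]
  refine ((hhalf.cos.smul_const v).fun_add
    (hhalf.sin.smul_const (colMul (pauliJ k) v))).congr_deriv ?_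
  simp only [colMul_apply, su2Basis]
  ext <;> simp <;> ring

theorem colMul_colMul (P Q : Matrix (Fin 2) (Fin 2) ℂ)
    (hP : P 1 1 = starRingEnd ℂ (P 0 0)) (hP' : P 0 1 = -starRingEnd ℂ (P 1 0)) (v : ℂ × ℂ) :
    colMul Q (colMul P v) = colMul (P * Q) v := by
  simp only [colMul_apply, Matrix.mul_apply, Fin.sum_univ_two, hP, hP']
  ext <;> simp <;> ring

theorem colMul_sub (P Q : Matrix (Fin 2) (Fin 2) ℂ) (v : ℂ × ℂ) :
    colMul (P - Q) v = colMul P v - colMul Q v := by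
  simp only [colMul_apply]
  ext <;> simp <;> ring

theorem colMul_commutator (k : Fin 3) (v : ℂ × ℂ) :
    colMul (su2Basis (k + 1)) (colMul (su2Basis k) v)
      - colMul (su2Basis k) (colMul (su2Basis (k + 1)) v) = colMul (su2Basis (k + 2)) v := by
  have h : ∀ k, su2Basis k 1 1 = starRingEnd ℂ (su2Basis k 0 0) ∧
      su2Basis k 0 1 = -starRingEnd ℂ (su2Basis k 1 0) := by
    intro k
    fin_cases k <;> simp [su2Basis, pauliJ, map_ofNat]
  rw [colMul_colMul _ _ (h _).1 (h _).2, colMul_colMul _ _ (h _).1 (h _).2, ← colMul_sub,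
    su2Basis_commutator]

/-! ### Derivatives along vector fields -/

section DirDeriv

variable {E F : Type*} [NormedAddCommGroup E] [NormedSpace ℝ E] [NormedAddCommGroup F]
  [NormedSpace ℝ F] {S : Set E} {V W : E → E} {f g : E → F}

/-- The derivative of `f` within `S` along the vector field `V`. -/
noncomputable def dirDeriv (S : Set E) (V : E → E) (f : E → F) : E → F :=
  fun x => fderivWithin ℝ f S x (V x)

theorem dirDeriv_congr (h : EqOn f g S) : EqOn (dirDeriv S V f) (dirDeriv S V g) S :=
  fun x hx => by simp only [dirDeriv, fderivWithin_congr h (h hx)]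

theorem contDiffOn_dirDeriv {n : ℕ} (hS : UniqueDiffOn ℝ S) (hV : ContDiff ℝ n V)
    (hf : ContDiffOn ℝ (n + 1 : ℕ) f S) : ContDiffOn ℝ n (dirDeriv S V f) S :=
  (hf.fderivWithin hS (by norm_cast)).clm_apply hV.contDiffOn

theorem dirDeriv_commutator (hS : UniqueDiffOn ℝ S) (hS' : S ⊆ closure (interior S))
    (hf : ContDiffOn ℝ 2 f S) {x : E} (hx : x ∈ S) (hV : DifferentiableAt ℝ V x)
    (hW : DifferentiableAt ℝ W x) :
    dirDeriv S V (dirDeriv S W f) x - dirDeriv S W (dirDeriv S V f) x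
      = dirDeriv S (VectorField.lieBracket ℝ V W) f x := by
  have hd : DifferentiableWithinAt ℝ (fderivWithin ℝ f S) S x :=
    (hf.fderivWithin hS (m := 1) (by norm_num)).differentiableOn one_ne_zero x hx
  have hsymm : IsSymmSndFDerivWithinAt ℝ f S x :=
    (hf x hx).isSymmSndFDerivWithinAt (by simp) hS (hS' hx) hx
  have second_deriv : ∀ {U : E → E}, DifferentiableAt ℝ U x → ∀ y : E,
      fderivWithin ℝ (dirDeriv S U f) S x y = fderivWithin ℝ f S x (fderiv ℝ U x y)
        + fderivWithin ℝ (fderivWithin ℝ f S) S x y (U x) := by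
    intro U hU y
    have hprod := (hd.hasFDerivWithinAt.clm_apply hU.hasFDerivAt.hasFDerivWithinAt).fderivWithin
      (hS x hx)
    exact congrArg (fun A : E →L[ℝ] F => A y) hprod
  calc dirDeriv S V (dirDeriv S W f) x - dirDeriv S W (dirDeriv S V f) x
      = fderivWithin ℝ (dirDeriv S W f) S x (V x)
        - fderivWithin ℝ (dirDeriv S V f) S x (W x) := rfl
    _ = fderivWithin ℝ f S x (fderiv ℝ W x (V x)) - fderivWithin ℝ f S x (fderiv ℝ V x (W x)) := by
        rw [second_deriv hW, second_deriv hV, hsymm (V x) (W x), add_sub_add_right_eq_sub]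
    _ = dirDeriv S (VectorField.lieBracket ℝ V W) f x := (map_sub _ _ _).symm

end DirDeriv

/-! ### Regularity of fields -/

/-- The lift of a field to `ℝ² × ℂ²` along `radialSU2`. -/
noncomputable def lift (f : Field) : (ℝ × ℝ) × (ℂ × ℂ) → ℂ := fun w => f w.1 (radialSU2 w.2)

/-- The domain of the lift of a field on `K × SU(2)`. -/
def liftDomain (K : Set (ℝ × ℝ)) : Set ((ℝ × ℝ) × (ℂ × ℂ)) := K ×ˢ {0}ᶜ

/-- A region without degenerate boundary points, on which one-sided derivatives are unique and
second derivatives are symmetric. -/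
structure RegularRegion (K : Set (ℝ × ℝ)) : Prop where
  uniqueDiffOn : UniqueDiffOn ℝ K
  subset_closure : K ⊆ closure (interior K)

theorem RegularRegion.univ : RegularRegion Set.univ := ⟨uniqueDiffOn_univ, by simp⟩

section Regularity

variable {K : Set (ℝ × ℝ)} {n : ℕ} {f f' : Field}

theorem RegularRegion.uniqueDiffOn_liftDomain (hK : RegularRegion K) :
    UniqueDiffOn ℝ (liftDomain K) :=
  hK.uniqueDiffOn.prod isOpen_compl_singleton.uniqueDiffOn

theorem RegularRegion.liftDomain_subset_closure (hK : RegularRegion K) :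
    liftDomain K ⊆ closure (interior (liftDomain K)) := by
  rw [liftDomain, interior_prod_eq, closure_prod_eq, isOpen_compl_singleton.interior_eq]
  exact prod_mono hK.subset_closure _root_.subset_closure

theorem eqOn_of_lift (h : EqOn (lift f) (lift f') (liftDomain K)) : EqOn f f' K := by
  intro z hz
  funext g
  simpa only [lift, radialSU2_firstCol] using
    h (show (z, firstCol g) ∈ liftDomain K from ⟨hz, firstCol_ne_zero g⟩)

theorem IsCk.of_le {m : ℕ} (hf : IsCk n K f) (h : m ≤ n) : IsCk m K f :=
  ContDiffOn.of_le hf (by exact_mod_cast h)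

theorem IsCk.add (hf : IsCk n K f) (hf' : IsCk n K f') : IsCk n K (f + f') := ContDiffOn.add hf hf'

theorem IsCk.mul (hf : IsCk n K f) (hf' : IsCk n K f') : IsCk n K (f * f') := ContDiffOn.mul hf hf'

theorem IsCk.conj (hf : IsCk n K f) : IsCk n K (fun z g => starRingEnd ℂ (f z g)) :=
  Complex.conjCLE.contDiff.comp_contDiffOn hf

theorem IsCk.const_smul (c : ℂ) (hf : IsCk n K f) : IsCk n K (c • f) :=
  ContDiffOn.mul contDiffOn_const hf

theorem IsCk.slice (hf : IsCk n K f) (g : SU2) : ContDiffOn ℝ n (fun w => f w g) K := by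
  have hsec : ContDiffOn ℝ n (fun w : ℝ × ℝ => (w, firstCol g)) K :=
    (contDiff_id.prodMk contDiff_const).contDiffOn
  refine (ContDiffOn.comp hf hsec fun w hw => ⟨hw, firstCol_ne_zero g⟩).congr fun w _ => ?_
  simp only [Function.comp, radialSU2_firstCol]

theorem IsCk.differentiableWithinAt (hf : IsCk 1 K f) {z : ℝ × ℝ} (hz : z ∈ K) (g : SU2) :
    DifferentiableWithinAt ℝ (fun w => f w g) K z :=
  (hf.slice g).differentiableOn (by simp) z hz

theorem IsCk.continuousOn (hf : IsCk n K f) :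
    ContinuousOn (fun x : (ℝ × ℝ) × SU2 => f x.1 x.2) (K ×ˢ Set.univ) := by
  have hsec : ContinuousOn (fun x : (ℝ × ℝ) × SU2 => (x.1, firstCol x.2)) (K ×ˢ Set.univ) :=
    (continuous_fst.prodMk (continuous_firstCol.comp continuous_snd)).continuousOn
  refine ((ContDiffOn.continuousOn hf).comp hsec
    fun x hx => ⟨hx.1, firstCol_ne_zero x.2⟩).congr fun x _ => ?_
  simp only [Function.comp, radialSU2_firstCol]

theorem IsCk.continuous_fiber (hf : IsCk n K f) {z : ℝ × ℝ} (hz : z ∈ K) : Continuous (f z) :=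
  hf.continuousOn.comp_continuous (f := fun g : SU2 => (z, g))
    (continuous_const.prodMk continuous_id) (fun _ => ⟨hz, mem_univ _⟩)

theorem IsCk.hasFDerivWithinAt_lift (hf : IsCk 1 K f) {w : (ℝ × ℝ) × (ℂ × ℂ)}
    (hw : w ∈ liftDomain K) :
    HasFDerivWithinAt (lift f) (fderivWithin ℝ (lift f) (liftDomain K) w) (liftDomain K) w :=
  (ContDiffOn.differentiableOn hf (by simp) w hw).hasFDerivWithinAt

/-! ### Operators of first order -/

/-- `A` behaves like a linear differential operator of first order on `K × SU(2)`. -/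
structure FirstOrder (K : Set (ℝ × ℝ)) (A : Field → Field) : Prop where
  isCk : ∀ {n : ℕ} {f : Field}, IsCk (n + 1) K f → IsCk n K (A f)
  congr : ∀ {f f' : Field}, EqOn f f' K → EqOn (A f) (A f') K
  map_add : ∀ {f f' : Field}, IsCk 1 K f → IsCk 1 K f' → EqOn (A (f + f')) (A f + A f') K
  map_smul : ∀ (c : ℂ) {f : Field}, IsCk 1 K f → EqOn (A (c • f)) (c • A f) K

/-- `A` and `B` commute on fields of class `C²`. -/
def Commutes (K : Set (ℝ × ℝ)) (A B : Field → Field) : Prop :=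
  ∀ ⦃f : Field⦄, IsCk 2 K f → EqOn (A (B f)) (B (A f)) K

/-- `A` differentiates along a vector field which lifts to the smooth vector field `V`. -/
structure IsVectorField (K : Set (ℝ × ℝ)) (A : Field → Field)
    (V : (ℝ × ℝ) × (ℂ × ℂ) → (ℝ × ℝ) × (ℂ × ℂ)) : Prop where
  contDiff : ContDiff ℝ (⊤ : ℕ∞) V
  congr : ∀ {f f' : Field}, EqOn f f' K → EqOn (A f) (A f') K
  lift_eqOn : ∀ {f : Field}, IsCk 1 K f →
    EqOn (lift (A f)) (dirDeriv (liftDomain K) V (lift f)) (liftDomain K)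

variable {A B C : Field → Field} {V W U : (ℝ × ℝ) × (ℂ × ℂ) → (ℝ × ℝ) × (ℂ × ℂ)} {a b : ℕ}

theorem FirstOrder.isCk_iterate (hA : FirstOrder K A) (hf : IsCk (n + a) K f) :
    IsCk n K (A^[a] f) := by
  induction a generalizing f with
  | zero => exact hf
  | succ a ih => exact ih (hA.isCk hf)

theorem FirstOrder.iterate_congr (hA : FirstOrder K A) (a : ℕ) (h : EqOn f f' K) :
    EqOn (A^[a] f) (A^[a] f') K := by
  induction a generalizing f f' with
  | zero => exact h
  | succ _ ih => exact ih (hA.congr h)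

theorem FirstOrder.iterate_add (hA : FirstOrder K A) (hf : IsCk a K f) (hf' : IsCk a K f') :
    EqOn (A^[a] (f + f')) (A^[a] f + A^[a] f') K := by
  induction a generalizing f f' with
  | zero => exact eqOn_refl _ _
  | succ a ih =>
    exact (hA.iterate_congr a (hA.map_add (hf.of_le (by omega)) (hf'.of_le (by omega)))).trans
      (ih (hA.isCk hf) (hA.isCk hf'))

theorem FirstOrder.iterate_smul (hA : FirstOrder K A) (c : ℂ) (hf : IsCk a K f) :
    EqOn (A^[a] (c • f)) (c • A^[a] f) K := by
  induction a generalizing f with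
  | zero => exact eqOn_refl _ _
  | succ a ih =>
    exact (hA.iterate_congr a (hA.map_smul c (hf.of_le (by omega)))).trans (ih (hA.isCk hf))

theorem FirstOrder.add (hA : FirstOrder K A) (hB : FirstOrder K B) :
    FirstOrder K (fun f => A f + B f) where
  isCk hf := (hA.isCk hf).add (hB.isCk hf)
  congr h _ hz := congrArg₂ (· + ·) (hA.congr h hz) (hB.congr h hz)
  map_add hf hf' _ hz :=
    (congrArg₂ (· + ·) (hA.map_add hf hf' hz) (hB.map_add hf hf' hz)).trans
      (add_add_add_comm _ _ _ _)
  map_smul c _ hf _ hz :=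
    (congrArg₂ (· + ·) (hA.map_smul c hf hz) (hB.map_smul c hf hz)).trans (smul_add c _ _).symm

theorem FirstOrder.const_smul (c : ℂ) (hA : FirstOrder K A) : FirstOrder K (fun f => c • A f) where
  isCk hf := (hA.isCk hf).const_smul c
  congr h _ hz := congrArg (c • ·) (hA.congr h hz)
  map_add hf hf' _ hz := (congrArg (c • ·) (hA.map_add hf hf' hz)).trans (smul_add _ _ _)
  map_smul c' _ hf _ hz := (congrArg (c • ·) (hA.map_smul c' hf hz)).trans (smul_comm c c' _)

theorem Commutes.iterate_right (hB : FirstOrder K B) (hAB : Commutes K A B)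
    (hf : IsCk (b + 1) K f) : EqOn (A (B^[b] f)) (B^[b] (A f)) K := by
  induction b generalizing f with
  | zero => exact eqOn_refl _ _
  | succ b ih =>
    exact (ih (hB.isCk hf)).trans (hB.iterate_congr b (hAB (hf.of_le (by omega))))

theorem Commutes.iterate (hA : FirstOrder K A) (hB : FirstOrder K B) (hAB : Commutes K A B)
    (hf : IsCk (a + b) K f) : EqOn (A^[a] (B^[b] f)) (B^[b] (A^[a] f)) K := by
  induction a generalizing f with
  | zero => exact eqOn_refl _ _
  | succ a ih =>
    exact (hA.iterate_congr a (hAB.iterate_right hB (hf.of_le (by omega)))).trans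
      (ih (hA.isCk (hf.of_le (by omega))))

theorem Commutes.add_right (hA : FirstOrder K A) (hB : FirstOrder K B) (hC : FirstOrder K C)
    (hAB : Commutes K A B) (hAC : Commutes K A C) : Commutes K A (fun f => B f + C f) := by
  intro f hf z hz
  exact (hA.map_add (hB.isCk hf) (hC.isCk hf) hz).trans
    (congrArg₂ (· + ·) (hAB hf hz) (hAC hf hz))

theorem Commutes.const_smul_right (c : ℂ) (hA : FirstOrder K A) (hB : FirstOrder K B)
    (hAB : Commutes K A B) : Commutes K A (fun f => c • B f) := by
  intro f hf z hz
  exact (hA.map_smul c (hB.isCk hf) hz).trans (congrArg (c • ·) (hAB hf hz))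

theorem IsVectorField.firstOrder (hK : RegularRegion K) (hA : IsVectorField K A V) :
    FirstOrder K A where
  isCk hf := (contDiffOn_dirDeriv hK.uniqueDiffOn_liftDomain
    (hA.contDiff.of_le (by exact_mod_cast le_top)) hf).congr
      (hA.lift_eqOn (hf.of_le (by omega)))
  congr := hA.congr
  map_add {f f'} hf hf' := by
    refine eqOn_of_lift fun w hw => (hA.lift_eqOn (hf.add hf') hw).trans ?_
    have hadd := ((hf.hasFDerivWithinAt_lift hw).add (hf'.hasFDerivWithinAt_lift hw)).fderivWithin
      (hK.uniqueDiffOn_liftDomain w hw)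
    exact (congrArg (fun L : _ →L[ℝ] ℂ => L (V w)) hadd).trans
      (congrArg₂ (· + ·) (hA.lift_eqOn hf hw).symm (hA.lift_eqOn hf' hw).symm)
  map_smul c f hf := by
    refine eqOn_of_lift fun w hw => (hA.lift_eqOn (hf.const_smul c) hw).trans ?_
    have hsmul := ((hf.hasFDerivWithinAt_lift hw).const_smul c).fderivWithin
      (hK.uniqueDiffOn_liftDomain w hw)
    exact (congrArg (fun L : _ →L[ℝ] ℂ => L (V w)) hsmul).trans
      (congrArg (c • ·) (hA.lift_eqOn hf hw).symm)

theorem IsVectorField.commutator (hK : RegularRegion K) (hA : IsVectorField K A V)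
    (hB : IsVectorField K B W) (hC : IsVectorField K C U) {κ : ℝ}
    (hκ : ∀ w, VectorField.lieBracket ℝ V W w = κ • U w) (hf : IsCk 2 K f) :
    EqOn (A (B f) - B (A f)) (κ • C f) K := by
  refine eqOn_of_lift fun w hw => ?_
  have hf1 : IsCk 1 K f := hf.of_le one_le_two
  have htwice : ∀ {A B V W}, IsVectorField K A V → IsVectorField K B W →
      lift (A (B f)) w = dirDeriv (liftDomain K) V (dirDeriv (liftDomain K) W (lift f)) w :=
    fun hA hB => (hA.lift_eqOn ((hB.firstOrder hK).isCk hf) hw).trans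
      (dirDeriv_congr (hB.lift_eqOn hf1) hw)
  change lift (A (B f)) w - lift (B (A f)) w = κ • lift (C f) w
  rw [htwice hA hB, htwice hB hA, hC.lift_eqOn hf1 hw,
    dirDeriv_commutator (f := lift f) hK.uniqueDiffOn_liftDomain hK.liftDomain_subset_closure hf hw
      (hA.contDiff.differentiable (by simp) w) (hB.contDiff.differentiable (by simp) w),
    dirDeriv, hκ, map_smul, dirDeriv]

theorem IsVectorField.commutes (hK : RegularRegion K) (hA : IsVectorField K A V)
    (hB : IsVectorField K B W) (h : ∀ w, VectorField.lieBracket ℝ V W w = 0) :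
    Commutes K A B := by
  intro f hf z hz
  have := hA.commutator hK hB hA (κ := 0) (fun w => by rw [h, zero_smul]) hf hz
  rwa [zero_smul, Pi.sub_apply, Pi.zero_apply, sub_eq_zero] at this

end Regularity

/-! ### The coordinate derivatives and the left-invariant frame -/

section Frame

variable {K : Set (ℝ × ℝ)} {n : ℕ} {f f' : Field}

theorem IsCk.fderivWithin_slice (hK : RegularRegion K) (hf : IsCk 1 K f) {z : ℝ × ℝ}
    (hz : z ∈ K) {v : ℂ × ℂ} (hv : v ≠ 0) (y : ℝ × ℝ) :
    fderivWithin ℝ (fun w => f w (radialSU2 v)) K z y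
      = fderivWithin ℝ (lift f) (liftDomain K) (z, v) (y, 0) := by
  have hinl : HasFDerivWithinAt (fun w : ℝ × ℝ => (w, v))
      (ContinuousLinearMap.inl ℝ (ℝ × ℝ) (ℂ × ℂ)) K z :=
    (hasFDerivAt_prodMk_left z v).hasFDerivWithinAt
  have hcomp := HasFDerivWithinAt.comp (t := liftDomain K) z
    (hf.hasFDerivWithinAt_lift (w := (z, v)) ⟨hz, hv⟩) hinl fun w hw => mk_mem_prod hw hv
  exact (congrArg (fun L : ℝ × ℝ →L[ℝ] ℂ => L y)
    (hcomp.fderivWithin (hK.uniqueDiffOn z hz)) :)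

theorem fderivWithin_slice_congr (h : EqOn f f' K) {z : ℝ × ℝ} (hz : z ∈ K) (y : ℝ × ℝ) :
    (fun g => fderivWithin ℝ (fun w => f w g) K z y)
      = fun g => fderivWithin ℝ (fun w => f' w g) K z y := by
  funext g
  rw [fderivWithin_congr (fun w hw => congrFun (h hw) g) (congrFun (h hz) g)]

theorem isVectorField_dTau (hK : RegularRegion K) :
    IsVectorField K (dTau K) (fun _ => ((1, 0), 0)) where
  contDiff := contDiff_const
  congr h _ hz := fderivWithin_slice_congr h hz (1, 0)
  lift_eqOn hf _ hw := hf.fderivWithin_slice hK hw.1 hw.2 (1, 0)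

theorem isVectorField_dRho (hK : RegularRegion K) :
    IsVectorField K (dRho K) (fun _ => ((0, 1), 0)) where
  contDiff := contDiff_const
  congr h _ hz := fderivWithin_slice_congr h hz (0, 1)
  lift_eqOn hf _ hw := hf.fderivWithin_slice hK hw.1 hw.2 (0, 1)

/-- The lift of the vector field `Zₖ`, which is linear. -/
noncomputable def liftZ (k : Fin 3) : (ℝ × ℝ) × (ℂ × ℂ) →L[ℝ] (ℝ × ℝ) × (ℂ × ℂ) :=
  (ContinuousLinearMap.inr ℝ (ℝ × ℝ) (ℂ × ℂ)).comp
    ((colMul (su2Basis k)).comp (ContinuousLinearMap.snd ℝ (ℝ × ℝ) (ℂ × ℂ)))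

theorem liftZ_apply (k : Fin 3) (w : (ℝ × ℝ) × (ℂ × ℂ)) :
    liftZ k w = (0, colMul (su2Basis k) w.2) := rfl

theorem IsCk.hasDerivAt_lift_oneParam (hf : IsCk 1 K f) (k : Fin 3) {z : ℝ × ℝ}
    (hz : z ∈ K) {v : ℂ × ℂ} (hv : v ≠ 0) :
    HasDerivAt (fun t : ℝ => f z (radialSU2 v * oneParam k t))
      (dirDeriv (liftDomain K) (liftZ k) (lift f) (z, v)) 0 := by
  have hcurve : HasDerivAt (fun t : ℝ => (z, colMul (oneParam k t).1 v))
      (0, colMul (su2Basis k) v) 0 :=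
    (hasDerivAt_const (0 : ℝ) z).prodMk (hasDerivAt_colMul_oneParam k v)
  have hv0 : colMul (oneParam k 0).1 v = v := by simp [colMul_oneParam]
  have hcomp := (hf.hasFDerivWithinAt_lift (w := (z, v)) ⟨hz, hv⟩).comp_hasDerivAt_of_eq
    (f := fun t : ℝ => (z, colMul (oneParam k t).1 v)) 0 hcurve
    (Filter.Eventually.of_forall fun t => ⟨hz, colMul_ne_zero _ hv⟩) (by simp only [hv0])
  refine hcomp.congr_of_eventuallyEq (Filter.Eventually.of_forall fun t => ?_)
  simp only [lift, Function.comp, radialSU2_mul _ hv]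

theorem IsCk.hasDerivAt_Z (hf : IsCk 1 K f) (k : Fin 3) {z : ℝ × ℝ} (hz : z ∈ K)
    (g : SU2) : HasDerivAt (fun t : ℝ => f z (g * oneParam k t)) (Z k f z g) 0 := by
  have h := hf.hasDerivAt_lift_oneParam k hz (firstCol_ne_zero g)
  rw [radialSU2_firstCol] at h
  exact h.differentiableAt.hasDerivAt

theorem isVectorField_Z (K : Set (ℝ × ℝ)) (k : Fin 3) : IsVectorField K (Z k) (liftZ k) where
  contDiff := (liftZ k).contDiff
  congr h _ hz := by
    funext g
    simp only [Z, h hz]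
  lift_eqOn hf w hw := (hf.hasDerivAt_lift_oneParam k (v := w.2) hw.1 hw.2).deriv

theorem firstOrder_dTau (hK : RegularRegion K) : FirstOrder K (dTau K) :=
  (isVectorField_dTau hK).firstOrder hK

theorem firstOrder_dRho (hK : RegularRegion K) : FirstOrder K (dRho K) :=
  (isVectorField_dRho hK).firstOrder hK

theorem firstOrder_Z (hK : RegularRegion K) (k : Fin 3) : FirstOrder K (Z k) :=
  (isVectorField_Z K k).firstOrder hK

theorem commutes_dTau_dRho (hK : RegularRegion K) : Commutes K (dTau K) (dRho K) :=
  (isVectorField_dTau hK).commutes hK (isVectorField_dRho hK)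
    fun w => by simp [VectorField.lieBracket]

theorem commutes_dTau_Z (hK : RegularRegion K) (k : Fin 3) : Commutes K (dTau K) (Z k) :=
  (isVectorField_dTau hK).commutes hK (isVectorField_Z K k)
    fun w => by simp [VectorField.lieBracket, liftZ_apply]

theorem commutes_dRho_Z (hK : RegularRegion K) (k : Fin 3) : Commutes K (dRho K) (Z k) :=
  (isVectorField_dRho hK).commutes hK (isVectorField_Z K k)
    fun w => by simp [VectorField.lieBracket, liftZ_apply]

theorem Z_commutator (hK : RegularRegion K) (k : Fin 3) (hf : IsCk 2 K f) :
    EqOn (Z k (Z (k + 1) f) - Z (k + 1) (Z k f)) (Z (k + 2) f) K := by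
  simpa only [one_smul] using (isVectorField_Z K k).commutator hK (isVectorField_Z K (k + 1))
    (isVectorField_Z K (k + 2)) (κ := 1)
    (fun w => by simp [VectorField.lieBracket, liftZ_apply, colMul_commutator]) hf

/-! ### Mixed derivatives -/

theorem isCk_Zpow (hK : RegularRegion K) {α : Fin 3 → ℕ} (hf : IsCk (n + ∑ l, α l) K f) :
    IsCk n K (Zpow α f) := by
  rw [Fin.sum_univ_three] at hf
  exact (firstOrder_Z hK 0).isCk_iterate ((firstOrder_Z hK 1).isCk_iterate
    ((firstOrder_Z hK 2).isCk_iterate (hf.of_le (by omega))))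

theorem Zpow_congr (h : EqOn f f' K) (α : Fin 3 → ℕ) : EqOn (Zpow α f) (Zpow α f') K := by
  have hiter : ∀ (k : Fin 3) (a : ℕ) {f f' : Field}, EqOn f f' K →
      EqOn ((Z k)^[a] f) ((Z k)^[a] f') K := by
    intro k a
    induction a with
    | zero => exact fun h => h
    | succ _ ih => exact fun h => ih ((isVectorField_Z K k).congr h)
  exact hiter 0 _ (hiter 1 _ (hiter 2 _ h))

theorem Commutes.iterate_Zpow {A : Field → Field} {a : ℕ} {α : Fin 3 → ℕ} (hK : RegularRegion K)
    (hA : FirstOrder K A) (hAZ : ∀ k, Commutes K A (Z k)) (hf : IsCk (a + ∑ l, α l) K f) :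
    EqOn (A^[a] (Zpow α f)) (Zpow α (A^[a] f)) K := by
  rw [Fin.sum_univ_three] at hf
  have hZ := firstOrder_Z hK
  have h2 : IsCk (a + α 0 + α 1) K ((Z 2)^[α 2] f) := (hZ 2).isCk_iterate (hf.of_le (by omega))
  have h1 : IsCk (a + α 0) K ((Z 1)^[α 1] ((Z 2)^[α 2] f)) := (hZ 1).isCk_iterate h2
  refine ((hAZ 0).iterate hA (hZ 0) h1).trans ((hZ 0).iterate_congr _ ?_)
  refine ((hAZ 1).iterate hA (hZ 1) (h2.of_le (by omega))).trans ((hZ 1).iterate_congr _ ?_)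
  exact (hAZ 2).iterate hA (hZ 2) (hf.of_le (by omega))

theorem isCk_dRho_dTau (hK : RegularRegion K) {P Q : ℕ} (hf : IsCk (n + P + Q) K f) :
    IsCk n K ((dRho K)^[P] ((dTau K)^[Q] f)) :=
  (firstOrder_dRho hK).isCk_iterate ((firstOrder_dTau hK).isCk_iterate hf)

theorem D_congr (hK : RegularRegion K) (p' q' : ℕ) (α : Fin 3 → ℕ) (h : EqOn f f' K) :
    EqOn (D K p' q' α f) (D K p' q' α f') K :=
  (firstOrder_dRho hK).iterate_congr _ ((firstOrder_dTau hK).iterate_congr _ (Zpow_congr h α))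

theorem D_dRho_dTau (hK : RegularRegion K) {p q p' q' : ℕ} {α : Fin 3 → ℕ}
    (hf : IsCk (p + q + (q' + p' + ∑ l, α l)) K f) :
    EqOn (D K p' q' α ((dRho K)^[p] ((dTau K)^[q] f)))
      (Zpow α ((dRho K)^[p + p'] ((dTau K)^[q + q'] f))) K := by
  have hT := firstOrder_dTau hK
  have hR := firstOrder_dRho hK
  have hF : IsCk (q' + p' + ∑ l, α l) K ((dRho K)^[p] ((dTau K)^[q] f)) :=
    isCk_dRho_dTau hK (hf.of_le (by omega))
  have hTZ := Commutes.iterate_Zpow hK hT (commutes_dTau_Z hK) (a := q') (α := α)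
    (hF.of_le (by omega))
  have hRZ := Commutes.iterate_Zpow hK hR (commutes_dRho_Z hK) (a := p') (α := α)
    (hT.isCk_iterate (a := q') (hF.of_le (by omega)))
  have hTR := hR.iterate_congr p' ((commutes_dTau_dRho hK).iterate hT hR (a := q') (b := p)
    (hT.isCk_iterate (a := q) (f := f) (hf.of_le (by omega))))
  rw [← Function.iterate_add_apply, ← Function.iterate_add_apply, add_comm p' p,
    add_comm q' q] at hTR
  exact (hR.iterate_congr p' hTZ).trans (hRZ.trans (Zpow_congr hTR α))

theorem D_dTau_dRho (hK : RegularRegion K) {p q p' q' : ℕ} {α : Fin 3 → ℕ}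
    (hf : IsCk (p + q + (q' + p' + ∑ l, α l)) K f) :
    EqOn (D K p' q' α ((dTau K)^[q] ((dRho K)^[p] f)))
      (Zpow α ((dRho K)^[p + p'] ((dTau K)^[q + q'] f))) K :=
  (D_congr hK p' q' α ((commutes_dTau_dRho hK).iterate (firstOrder_dTau hK) (firstOrder_dRho hK)
    (hf.of_le (by omega)))).trans (D_dRho_dTau hK hf)

/-! ### Commutation of a transport equation with derivatives -/

/-- The transport operator `(c + d τ) ∂_τ + e ρ ∂_ρ`. -/
noncomputable def transport (K : Set (ℝ × ℝ)) (c d e : ℝ) (f : Field) : Field :=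
  fun z => (c + d * z.1) • dTau K f z + (e * z.2) • dRho K f z

/-- The lift of the vector field `(c + d τ) ∂_τ + e ρ ∂_ρ`. -/
def liftTransport (c d e : ℝ) (w : (ℝ × ℝ) × (ℂ × ℂ)) : (ℝ × ℝ) × (ℂ × ℂ) :=
  ((c + d * w.1.1, e * w.1.2), 0)

theorem isVectorField_transport (hK : RegularRegion K) (c d e : ℝ) :
    IsVectorField K (transport K c d e) (liftTransport c d e) where
  contDiff := by unfold liftTransport; fun_prop
  congr h z hz := by
    simp only [transport, (isVectorField_dTau hK).congr h hz, (isVectorField_dRho hK).congr h hz]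
  lift_eqOn {f} hf w hw := by
    have hsplit : liftTransport c d e w
        = (c + d * w.1.1) • ((1, 0), 0) + (e * w.1.2) • ((0, 1), 0) := by simp [liftTransport]
    calc lift (transport K c d e f) w
        = (c + d * w.1.1) • lift (dTau K f) w + (e * w.1.2) • lift (dRho K f) w := rfl
      _ = dirDeriv (liftDomain K) (liftTransport c d e) (lift f) w := by
        rw [(isVectorField_dTau hK).lift_eqOn hf hw, (isVectorField_dRho hK).lift_eqOn hf hw,
          dirDeriv, dirDeriv, dirDeriv, hsplit, map_add, map_smul, map_smul]

/-- `u` satisfies the transport equation `(c + d τ) ∂_τ u + e ρ ∂_ρ u + a u = h` on `K × SU(2)`. -/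
def Transports (K : Set (ℝ × ℝ)) (c d e a : ℝ) (u h : Field) : Prop :=
  EqOn (transport K c d e u + a • u) h K

variable {c d e a κ : ℝ} {u w h h' : Field} {B : Field → Field}
  {W : (ℝ × ℝ) × (ℂ × ℂ) → (ℝ × ℝ) × (ℂ × ℂ)}

theorem FirstOrder.map_real_smul (hB : FirstOrder K B) (r : ℝ) (hf : IsCk 1 K f) :
    EqOn (B (r • f)) (r • B f) K := by
  simpa only [Complex.coe_smul] using hB.map_smul (r : ℂ) hf

theorem Transports.map (hK : RegularRegion K) (hB : IsVectorField K B W)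
    (hκ : ∀ w, VectorField.lieBracket ℝ (liftTransport c d e) W w = (-κ) • W w)
    (hu : IsCk 2 K u) (H : Transports K c d e a u h) :
    Transports K c d e (a + κ) (B u) (B h) := by
  have hT := isVectorField_transport hK c d e
  have hB' := hB.firstOrder hK
  have hu1 : IsCk 1 K u := hu.of_le one_le_two
  have hau : IsCk 1 K (a • u) := hu1.const_smul (a : ℂ)
  intro z hz
  have hcomm : transport K c d e (B u) z - B (transport K c d e u) z = (-κ) • B u z :=
    hT.commutator hK hB hB hκ hu hz
  calc (transport K c d e (B u) + (a + κ) • B u) z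
      = transport K c d e (B u) z + (a + κ) • B u z := rfl
    _ = B (transport K c d e u) z + a • B u z := by
      rw [sub_eq_iff_eq_add.mp hcomm, neg_smul, add_smul]
      abel
    _ = B (transport K c d e u + a • u) z := by
      rw [hB'.map_add ((hT.firstOrder hK).isCk hu) hau hz, Pi.add_apply,
        hB'.map_real_smul a hu1 hz, Pi.smul_apply]
    _ = B h z := hB'.congr H hz

theorem Transports.iterate (hK : RegularRegion K) (hB : IsVectorField K B W)
    (hκ : ∀ w, VectorField.lieBracket ℝ (liftTransport c d e) W w = (-κ) • W w)
    (hu : IsCk (n + 1) K u) (H : Transports K c d e a u h) :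
    Transports K c d e (a + n * κ) (B^[n] u) (B^[n] h) := by
  induction n generalizing a u h with
  | zero => simpa using H
  | succ n ih =>
    have hstep := ih ((hB.firstOrder hK).isCk hu) (H.map hK hB hκ (hu.of_le (by omega)))
    rwa [add_assoc, ← one_add_mul, add_comm (1 : ℝ), ← Nat.cast_succ] at hstep

theorem hasFDerivAt_liftTransport (c d e : ℝ) (w : (ℝ × ℝ) × (ℂ × ℂ)) :
    HasFDerivAt (liftTransport c d e) (((d • (ContinuousLinearMap.fst ℝ ℝ ℝ ∘SL
      ContinuousLinearMap.fst ℝ (ℝ × ℝ) (ℂ × ℂ))).prod (e • (ContinuousLinearMap.snd ℝ ℝ ℝ ∘SL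
        ContinuousLinearMap.fst ℝ (ℝ × ℝ) (ℂ × ℂ)))).prod 0) w :=
  (((hasFDerivAt_fst.fst.const_mul d).const_add c).prodMk
    (hasFDerivAt_fst.snd.const_mul e)).prodMk (hasFDerivAt_const 0 w)

theorem Transports.iterate_dTau (hK : RegularRegion K) (hu : IsCk (n + 1) K u)
    (H : Transports K c d e a u h) :
    Transports K c d e (a + n * d) ((dTau K)^[n] u) ((dTau K)^[n] h) :=
  H.iterate hK (isVectorField_dTau hK) (fun w => by
    simp [VectorField.lieBracket, (hasFDerivAt_liftTransport c d e w).fderiv]) hu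

theorem Transports.iterate_dRho (hK : RegularRegion K) (hu : IsCk (n + 1) K u)
    (H : Transports K c d e a u h) :
    Transports K c d e (a + n * e) ((dRho K)^[n] u) ((dRho K)^[n] h) :=
  H.iterate hK (isVectorField_dRho hK) (fun w => by
    simp [VectorField.lieBracket, (hasFDerivAt_liftTransport c d e w).fderiv]) hu

theorem Transports.iterate_Z (hK : RegularRegion K) (k : Fin 3) (hu : IsCk (n + 1) K u)
    (H : Transports K c d e a u h) :
    Transports K c d e a ((Z k)^[n] u) ((Z k)^[n] h) := by
  have hstep := H.iterate hK (isVectorField_Z K k) (κ := 0) (fun w => by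
    simp [VectorField.lieBracket, (hasFDerivAt_liftTransport c d e w).fderiv, liftZ_apply,
      liftTransport]) hu
  rwa [mul_zero, add_zero] at hstep

theorem Transports.iterate_Zpow (hK : RegularRegion K) {α : Fin 3 → ℕ}
    (hu : IsCk (∑ l, α l + 1) K u) (H : Transports K c d e a u h) :
    Transports K c d e a (Zpow α u) (Zpow α h) := by
  rw [Fin.sum_univ_three] at hu
  have hZ := firstOrder_Z hK
  have h2 : IsCk (α 0 + α 1 + 1) K ((Z 2)^[α 2] u) := (hZ 2).isCk_iterate (hu.of_le (by omega))
  have h1 : IsCk (α 0 + 1) K ((Z 1)^[α 1] ((Z 2)^[α 2] u)) :=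
    (hZ 1).isCk_iterate (h2.of_le (by omega))
  exact ((H.iterate_Z hK 2 (hu.of_le (by omega))).iterate_Z hK 1 (h2.of_le (by omega))).iterate_Z
    hK 0 h1

/-- The operator `x Z₂ + y Z₁`, of which `X₊` and `X₋` are special cases. -/
noncomputable def xField (x y : ℂ) (f : Field) : Field := x • Z 1 f + y • Z 0 f

theorem firstOrder_xField (hK : RegularRegion K) (x y : ℂ) : FirstOrder K (xField x y) :=
  ((firstOrder_Z hK 1).const_smul x).add ((firstOrder_Z hK 0).const_smul y)

theorem Commutes.xField_right (hK : RegularRegion K) (hB : FirstOrder K B)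
    (hBZ : ∀ k, Commutes K B (Z k)) (x y : ℂ) : Commutes K B (xField x y) :=
  ((hBZ 1).const_smul_right x hB (firstOrder_Z hK 1)).add_right hB
    ((firstOrder_Z hK 1).const_smul x) ((firstOrder_Z hK 0).const_smul y)
    ((hBZ 0).const_smul_right y hB (firstOrder_Z hK 0))

theorem Transports.commute (hK : RegularRegion K) {x y : ℂ} {P Q : ℕ} {α : Fin 3 → ℕ}
    (hu : IsCk (P + Q + ∑ l, α l + 1) K u) (hw : IsCk (P + Q + 1) K w)
    (H : Transports K c d e a u (xField x y w)) :
    Transports K c d e (a + Q * d + P * e) (Zpow α ((dRho K)^[P] ((dTau K)^[Q] u)))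
      (Zpow α (xField x y ((dRho K)^[P] ((dTau K)^[Q] w)))) := by
  have hT := firstOrder_dTau hK
  have hR := firstOrder_dRho hK
  have hX := firstOrder_xField hK x y
  have hTX : EqOn ((dTau K)^[Q] (xField x y w)) (xField x y ((dTau K)^[Q] w)) K :=
    (Commutes.xField_right hK hT (commutes_dTau_Z hK) x y).iterate hT hX (b := 1)
      (hw.of_le (by omega))
  have hRX : EqOn ((dRho K)^[P] (xField x y ((dTau K)^[Q] w)))
      (xField x y ((dRho K)^[P] ((dTau K)^[Q] w))) K :=
    (Commutes.xField_right hK hR (commutes_dRho_Z hK) x y).iterate hR hX (b := 1)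
      (hT.isCk_iterate (hw.of_le (by omega)))
  have hmain := ((H.iterate_dTau hK (n := Q) (hu.of_le (by omega))).iterate_dRho hK (n := P)
    (hT.isCk_iterate (hu.of_le (by omega)))).iterate_Zpow hK (α := α)
      (isCk_dRho_dTau hK (hu.of_le (by omega)))
  exact EqOn.trans hmain (Zpow_congr ((hR.iterate_congr P hTX).trans hRX) α)

end Frame

/-! ### The enveloping algebra of the left-invariant fields -/

/-- `h` is of class `C^n` on `SU(2)`. -/
def IsCkGroup (n : ℕ) (h : SU2 → ℂ) : Prop := IsCk n Set.univ fun _ => h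

/-- The left-invariant field `Zₖ` on functions on `SU(2)`. -/
noncomputable def zDeriv (k : Fin 3) (h : SU2 → ℂ) : SU2 → ℂ :=
  fun g => deriv (fun t : ℝ => h (g * oneParam k t)) 0

/-- The monomial `Z^α` on functions on `SU(2)`. -/
noncomputable def zMono (α : Fin 3 → ℕ) (h : SU2 → ℂ) : SU2 → ℂ :=
  (zDeriv 0)^[α 0] ((zDeriv 1)^[α 1] ((zDeriv 2)^[α 2] h))

theorem Z_iterate_apply (k : Fin 3) (n : ℕ) (f : Field) (z : ℝ × ℝ) :
    (Z k)^[n] f z = (zDeriv k)^[n] (f z) := by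
  induction n generalizing f with
  | zero => rfl
  | succ _ ih => exact ih (Z k f)

theorem Zpow_apply (α : Fin 3 → ℕ) (f : Field) (z : ℝ × ℝ) : Zpow α f z = zMono α (f z) := by
  rw [Zpow, zMono, Z_iterate_apply, Z_iterate_apply, Z_iterate_apply]

theorem IsCk.fiber {K : Set (ℝ × ℝ)} {n : ℕ} {f : Field} (hf : IsCk n K f) {z : ℝ × ℝ}
    (hz : z ∈ K) : IsCkGroup n (f z) := by
  have hfiber : ContDiffOn ℝ n (fun w : (ℝ × ℝ) × (ℂ × ℂ) => (z, w.2)) (Set.univ ×ˢ {0}ᶜ) :=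
    (contDiff_const.prodMk contDiff_snd).contDiffOn
  exact ContDiffOn.comp (t := K ×ˢ {0}ᶜ) hf hfiber fun w hw => ⟨hz, hw.2⟩

section GroupFunctions

variable {n m : ℕ} {h h' : SU2 → ℂ}

theorem IsCkGroup.of_le (hh : IsCkGroup n h) (hm : m ≤ n) : IsCkGroup m h := IsCk.of_le hh hm

theorem IsCkGroup.continuous (hh : IsCkGroup n h) : Continuous h :=
  IsCk.continuous_fiber hh (mem_univ (0, 0))

theorem IsCkGroup.add (hh : IsCkGroup n h) (hh' : IsCkGroup n h') : IsCkGroup n (h + h') :=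
  IsCk.add hh hh'

theorem IsCkGroup.smul (c : ℂ) (hh : IsCkGroup n h) : IsCkGroup n (c • h) := IsCk.const_smul c hh

theorem isCkGroup_zero : IsCkGroup n 0 := contDiffOn_const (c := (0 : ℂ))

theorem isCkGroup_zDeriv (hh : IsCkGroup (n + 1) h) (k : Fin 3) : IsCkGroup n (zDeriv k h) :=
  (firstOrder_Z RegularRegion.univ k).isCk hh

theorem IsCkGroup.hasDerivAt (hh : IsCkGroup 1 h) (k : Fin 3) (g : SU2) :
    HasDerivAt (fun t : ℝ => h (g * oneParam k t)) (zDeriv k h g) 0 :=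
  IsCk.hasDerivAt_Z hh k (mem_univ (0, 0)) g

theorem zDeriv_add (hh : IsCkGroup 1 h) (hh' : IsCkGroup 1 h') (k : Fin 3) :
    zDeriv k (h + h') = zDeriv k h + zDeriv k h' :=
  (firstOrder_Z RegularRegion.univ k).map_add hh hh' (mem_univ (0, 0))

theorem zDeriv_smul (c : ℂ) (h : SU2 → ℂ) (k : Fin 3) : zDeriv k (c • h) = c • zDeriv k h :=
  funext fun _ => deriv_const_mul_field c

theorem zDeriv_zero (k : Fin 3) : zDeriv k 0 = 0 := funext fun g => by simp [zDeriv]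

theorem zDeriv_comm (j i : Fin 3) : ∃ c : Fin 3 → ℂ, ∀ h, IsCkGroup 2 h →
    zDeriv j (zDeriv i h) = zDeriv i (zDeriv j h) + ∑ k, c k • zDeriv k h := by
  have hcyclic : ∀ k h, IsCkGroup 2 h →
      zDeriv k (zDeriv (k + 1) h) - zDeriv (k + 1) (zDeriv k h) = zDeriv (k + 2) h :=
    fun k h hh => Z_commutator RegularRegion.univ k hh (mem_univ (0, 0))
  have hsingle : ∀ (k : Fin 3) (x : ℂ) (h : SU2 → ℂ),
      ∑ l, (Pi.single k x : Fin 3 → ℂ) l • zDeriv l h = x • zDeriv k h := fun k x h => by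
    rw [Finset.sum_eq_single k (fun l _ hl => by simp [Pi.single_eq_of_ne hl]) (by simp),
      Pi.single_eq_same]
  have hcases : i = j ∨ i = j + 1 ∨ j = i + 1 := by decide +revert
  rcases hcases with rfl | rfl | rfl
  · exact ⟨0, fun h _ => by simp⟩
  · refine ⟨Pi.single (j + 2) 1, fun h hh => ?_⟩
    rw [hsingle, one_smul, ← hcyclic j h hh]
    abel
  · refine ⟨Pi.single (i + 2) (-1), fun h hh => ?_⟩
    rw [hsingle, neg_one_smul, ← hcyclic i h hh]
    abel

theorem zMono_zero (h : SU2 → ℂ) : zMono 0 h = h := rfl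

theorem zMono_add_single {α : Fin 3 → ℕ} {i : Fin 3} (hi : ∀ l < i, α l = 0) (h : SU2 → ℂ) :
    zMono (α + Pi.single i 1) h = zDeriv i (zMono α h) := by
  have hne : ∀ l ≠ i, (α + Pi.single i 1 : Fin 3 → ℕ) l = α l := fun l hl => by
    rw [Pi.add_apply, Pi.single_eq_of_ne hl, add_zero]
  have heq : (α + Pi.single i 1 : Fin 3 → ℕ) i = α i + 1 := by
    rw [Pi.add_apply, Pi.single_eq_same]
  have hcases : i = 0 ∨ i = 1 ∨ i = 2 := by clear hi hne heq; decide +revert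
  rcases hcases with rfl | rfl | rfl
  · rw [zMono, zMono, heq, hne 1 (by decide), hne 2 (by decide), Function.iterate_succ_apply']
  · rw [zMono, zMono, heq, hne 0 (by decide), hne 2 (by decide), hi 0 (by decide),
      Function.iterate_succ_apply', Function.iterate_zero, id, id]
  · rw [zMono, zMono, heq, hne 0 (by decide), hne 1 (by decide), hi 0 (by decide),
      hi 1 (by decide), Function.iterate_succ_apply']
    simp only [Function.iterate_zero, id]

theorem sum_add_single (α : Fin 3 → ℕ) (i : Fin 3) :
    ∑ l, (α + Pi.single i 1 : Fin 3 → ℕ) l = ∑ l, α l + 1 := by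
  simp [Finset.sum_add_distrib]

theorem multiIndex_cases (α : Fin 3 → ℕ) :
    α = 0 ∨ ∃ (β : Fin 3 → ℕ) (i : Fin 3), (∀ l < i, β l = 0) ∧ α = β + Pi.single i 1 := by
  refine or_iff_not_imp_left.mpr fun hα => ?_
  obtain ⟨i, hi, hmin⟩ := WellFounded.has_min wellFounded_lt {l | α l ≠ 0}
    (Function.ne_iff.mp hα)
  have hzero : ∀ l < i, α l = 0 := fun l hl => by_contra fun hl0 => hmin l hl0 hl
  refine ⟨α - Pi.single i 1, i, fun l hl => by simp [hzero l hl], ?_⟩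
  refine (tsub_add_cancel_of_le fun l => ?_).symm
  rcases eq_or_ne l i with rfl | hl
  · simpa [Nat.one_le_iff_ne_zero] using hi
  · simp [Pi.single_eq_of_ne hl]

theorem multiIndex_induction {P : (Fin 3 → ℕ) → Prop} (zero : P 0)
    (add_single : ∀ β i, (∀ l < i, β l = 0) → P β → P (β + Pi.single i 1)) (α : Fin 3 → ℕ) :
    P α := by
  induction hn : ∑ l, α l using Nat.strong_induction_on generalizing α with
  | _ n ih =>
    rcases multiIndex_cases α with rfl | ⟨β, i, hi, rfl⟩
    · exact zero
    · rw [sum_add_single] at hn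
      exact add_single β i hi (ih _ (by omega) β rfl)

theorem isCkGroup_zMono {α : Fin 3 → ℕ} (hh : IsCkGroup (n + ∑ l, α l) h) :
    IsCkGroup n (zMono α h) := by
  have hZ := isCk_Zpow RegularRegion.univ hh
  rwa [show Zpow α (fun _ => h) = fun _ => zMono α h from funext (Zpow_apply α _)] at hZ

theorem zMono_add {α : Fin 3 → ℕ} (hh : IsCkGroup (∑ l, α l) h) (hh' : IsCkGroup (∑ l, α l) h') :
    zMono α (h + h') = zMono α h + zMono α h' := by
  induction α using multiIndex_induction with
  | zero => rfl
  | add_single β i hi ih =>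
    rw [sum_add_single] at hh hh'
    rw [zMono_add_single hi, zMono_add_single hi, zMono_add_single hi,
      ih (hh.of_le (by omega)) (hh'.of_le (by omega)),
      zDeriv_add (isCkGroup_zMono (hh.of_le (by omega))) (isCkGroup_zMono (hh'.of_le (by omega)))]

theorem zMono_smul (c : ℂ) (α : Fin 3 → ℕ) (h : SU2 → ℂ) :
    zMono α (c • h) = c • zMono α h := by
  induction α using multiIndex_induction with
  | zero => rfl
  | add_single β i hi ih => rw [zMono_add_single hi, zMono_add_single hi, ih, zDeriv_smul]

end GroupFunctions

/-- The multi-indices of order at most `n`. -/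
def multiIndices (n : ℕ) : Finset (Fin 3 → ℕ) :=
  (Fintype.piFinset fun _ : Fin 3 => Finset.range (n + 1)).filter fun α => ∑ i, α i ≤ n

theorem mem_multiIndices {n : ℕ} {α : Fin 3 → ℕ} : α ∈ multiIndices n ↔ ∑ i, α i ≤ n := by
  simp only [multiIndices, Finset.mem_filter, Fintype.mem_piFinset, Finset.mem_range,
    and_iff_right_iff_imp]
  intro h i
  have hi := Finset.single_le_sum (f := α) (fun _ _ => Nat.zero_le _) (Finset.mem_univ i)
  omega

/-- The operators on functions of class `C^N`. -/
abbrev Operator (N : ℕ) : Type := {h : SU2 → ℂ // IsCkGroup N h} → SU2 → ℂ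

/-- The operator `Z^α`. -/
noncomputable def monoOp (N : ℕ) (α : Fin 3 → ℕ) : Operator N := fun h => zMono α h.1

/-- The linear combinations of the operators `Z^α` with `|α| ≤ n`, that is the `n`-th step of the
Poincaré–Birkhoff–Witt filtration. -/
noncomputable def filtration (N n : ℕ) : Submodule ℂ (Operator N) :=
  Submodule.span ℂ (monoOp N '' multiIndices n)

section Filtration

variable {N n : ℕ}

theorem monoOp_mem_filtration {α : Fin 3 → ℕ} (hα : ∑ l, α l ≤ n) :
    monoOp N α ∈ filtration N n :=
  Submodule.subset_span ⟨α, mem_multiIndices.mpr hα, rfl⟩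

theorem filtration_mono {n' : ℕ} (h : n ≤ n') : filtration N n ≤ filtration N n' :=
  Submodule.span_mono (image_mono fun _ hα =>
    mem_multiIndices.mpr ((mem_multiIndices.mp hα).trans h))

theorem isCkGroup_of_mem_filtration {y : Operator N} (hy : y ∈ filtration N n) {k : ℕ}
    (hn : n + k ≤ N) (h : {h : SU2 → ℂ // IsCkGroup N h}) : IsCkGroup k (y h) := by
  induction hy using Submodule.span_induction with
  | mem x hx =>
    obtain ⟨α, hα, rfl⟩ := hx
    have hα' := mem_multiIndices.mp hα
    exact isCkGroup_zMono (h.2.of_le (by omega))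
  | zero => exact isCkGroup_zero
  | add x y _ _ hx hy => exact hx.add hy
  | smul c x _ hx => exact hx.smul c

theorem zDeriv_mem_filtration_of {i : Fin 3}
    (H : ∀ α : Fin 3 → ℕ, ∑ l, α l ≤ n →
      (fun h => zDeriv i (monoOp N α h)) ∈ filtration N (∑ l, α l + 1))
    {y : Operator N} (hy : y ∈ filtration N n) (hn : n + 1 ≤ N) :
    (fun h => zDeriv i (y h)) ∈ filtration N (n + 1) := by
  induction hy using Submodule.span_induction with
  | mem x hx =>
    obtain ⟨α, hα, rfl⟩ := hx
    have hα' := mem_multiIndices.mp hα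
    exact filtration_mono (by omega) (H α hα')
  | zero =>
    simp only [Pi.zero_apply, zDeriv_zero]
    exact zero_mem _
  | add x y hx' hy' hx hy =>
    have hadd : (fun h => zDeriv i ((x + y) h))
        = (fun h => zDeriv i (x h)) + fun h => zDeriv i (y h) := funext fun h =>
      zDeriv_add (isCkGroup_of_mem_filtration hx' hn h) (isCkGroup_of_mem_filtration hy' hn h) i
    rw [hadd]
    exact add_mem hx hy
  | smul c x _ hx =>
    have hsmul : (fun h => zDeriv i ((c • x) h)) = c • fun h => zDeriv i (x h) :=
      funext fun h => zDeriv_smul c (x h) i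
    rw [hsmul]
    exact Submodule.smul_mem _ c hx

theorem zDeriv_monoOp_mem_filtration_of_ordered {α : Fin 3 → ℕ} {j : Fin 3}
    (hα : ∀ l < j, α l = 0) :
    (fun h => zDeriv j (monoOp N α h)) ∈ filtration N (∑ l, α l + 1) := by
  rw [show (fun h => zDeriv j (monoOp N α h)) = monoOp N (α + Pi.single j 1) from
    funext fun h => (zMono_add_single hα h.1).symm]
  exact monoOp_mem_filtration (sum_add_single α j).le

-- Exchanging `Zⱼ` with the factor `Zᵢ` of `Z^α = Zᵢ Z^β`, where `i < j`, leaves `Zᵢ` in front of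
-- operators of order at most `|α|`, which is covered by the induction on `j`, and operators of
-- lower order.
theorem zDeriv_monoOp_mem_filtration {α : Fin 3 → ℕ} (hN : ∑ l, α l + 1 ≤ N) (j : Fin 3) :
    (fun h => zDeriv j (monoOp N α h)) ∈ filtration N (∑ l, α l + 1) := by
  induction hα : ∑ l, α l using Nat.strong_induction_on generalizing α j with
  | _ n ih_order =>
  induction j using WellFoundedLT.induction generalizing α with
  | _ j ih_index =>
  subst hα
  rcases multiIndex_cases α with rfl | ⟨β, i, hi, rfl⟩
  · exact zDeriv_monoOp_mem_filtration_of_ordered fun _ _ => rfl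
  rcases le_or_gt j i with hji | hij
  · exact zDeriv_monoOp_mem_filtration_of_ordered fun l hl => by
      simp [hi l (hl.trans_le hji), Pi.single_eq_of_ne (hl.trans_le hji).ne]
  simp only [sum_add_single] at *
  obtain ⟨c, hc⟩ := zDeriv_comm j i
  have hβ : ∀ k, (fun h => zDeriv k (monoOp N β h)) ∈ filtration N (∑ l, β l + 1) :=
    fun k => ih_order _ (Nat.lt_succ_self _) (by omega) k rfl
  have hexchanged := zDeriv_mem_filtration_of (i := i) (fun γ hγ => by
    rcases hγ.lt_or_eq with hlt | heq
    · exact ih_order _ hlt (by omega) i rfl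
    · exact heq ▸ ih_index i hij (by omega) heq) (hβ j) hN
  have hlower : ∑ k, c k • (fun h => zDeriv k (monoOp N β h)) ∈ filtration N (∑ l, β l + 1 + 1) :=
    Submodule.sum_mem _ fun k _ => Submodule.smul_mem _ _ (filtration_mono (Nat.le_succ _) (hβ k))
  convert add_mem hexchanged hlower using 1
  funext h
  simp only [monoOp, Pi.add_apply, Finset.sum_apply, Pi.smul_apply, zMono_add_single hi]
  exact hc _ (isCkGroup_zMono (h.2.of_le (by omega)))

theorem zDeriv_mem_filtration {y : Operator N} (hy : y ∈ filtration N n) (hn : n + 1 ≤ N)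
    (i : Fin 3) : (fun h => zDeriv i (y h)) ∈ filtration N (n + 1) :=
  zDeriv_mem_filtration_of (fun _ _ => zDeriv_monoOp_mem_filtration (by omega) i) hy hn

theorem zMono_zDeriv_commutator_mem_filtration (j : Fin 3) (α : Fin 3 → ℕ)
    (hN : ∑ l, α l + 1 ≤ N) :
    ((fun h => zMono α (zDeriv j h.1) - zDeriv j (zMono α h.1)) : Operator N)
      ∈ filtration N (∑ l, α l) := by
  induction α using multiIndex_induction with
  | zero =>
    simp only [zMono_zero, sub_self]
    exact zero_mem _
  | add_single β i hi ih =>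
    rw [sum_add_single] at hN ⊢
    obtain ⟨c, hc⟩ := zDeriv_comm j i
    have hy := ih (by omega)
    have hsum : ∑ k, c k • (fun h => zDeriv k (monoOp N β h)) ∈ filtration N (∑ l, β l + 1) :=
      Submodule.sum_mem _ fun k _ =>
        Submodule.smul_mem _ _ (zDeriv_monoOp_mem_filtration (by omega) k)
    convert sub_mem (zDeriv_mem_filtration hy (by omega) i) hsum using 1
    funext h
    have hreg : IsCkGroup 2 (zMono β h.1) := isCkGroup_zMono (h.2.of_le (by omega))
    have hsplit : zMono β (zDeriv j h.1)
        = (zMono β (zDeriv j h.1) - zDeriv j (zMono β h.1)) + zDeriv j (zMono β h.1) :=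
      (sub_add_cancel _ _).symm
    simp only [Pi.sub_apply, Finset.sum_apply, Pi.smul_apply, monoOp]
    rw [zMono_add_single hi, zMono_add_single hi, hc _ hreg]
    nth_rewrite 1 [hsplit]
    rw [zDeriv_add (isCkGroup_of_mem_filtration hy (by omega) h) (isCkGroup_zDeriv hreg j)]
    abel

theorem exists_bound_of_mem_filtration {y : Operator N} (hy : y ∈ filtration N n) :
    ∃ C : ℝ, 0 ≤ C ∧ ∀ h g, ‖y h g‖ ^ 2 ≤ C * ∑ β ∈ multiIndices n, ‖zMono β h.1 g‖ ^ 2 := by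
  obtain ⟨c, rfl⟩ := Submodule.mem_span_image_finset_iff_exists_fun' ℂ |>.mp hy
  refine ⟨∑ β ∈ multiIndices n, ‖c β‖ ^ 2, by positivity, fun h g => ?_⟩
  calc ‖(∑ β ∈ multiIndices n, c β • monoOp N β) h g‖ ^ 2
      = ‖∑ β ∈ multiIndices n, c β * zMono β h.1 g‖ ^ 2 := by simp [monoOp]
    _ ≤ (∑ β ∈ multiIndices n, ‖c β‖ * ‖zMono β h.1 g‖) ^ 2 := by
        gcongr
        exact (norm_sum_le _ _).trans_eq (by simp only [norm_mul])
    _ ≤ _ := Finset.sum_mul_sq_le_sq_mul_sq _ _ _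

end Filtration

/-- The operator `a Z₂ + b Z₁` on functions on `SU(2)`. -/
noncomputable def xOp (a b : ℂ) (h : SU2 → ℂ) : SU2 → ℂ := a • zDeriv 1 h + b • zDeriv 0 h

theorem xField_apply (a b : ℂ) (f : Field) (z : ℝ × ℝ) : xField a b f z = xOp a b (f z) := rfl

theorem continuous_xOp {a b : ℂ} {h : SU2 → ℂ} (hh : IsCkGroup 1 h) : Continuous (xOp a b h) :=
  ((isCkGroup_zDeriv (n := 0) hh 1).smul a |>.add
    ((isCkGroup_zDeriv (n := 0) hh 0).smul b)).continuous

theorem zMono_xOp_commutator_mem_filtration (a b : ℂ) (α : Fin 3 → ℕ) {N : ℕ}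
    (hN : ∑ l, α l + 1 ≤ N) :
    ((fun h => zMono α (xOp a b h.1) - xOp a b (zMono α h.1)) : Operator N)
      ∈ filtration N (∑ l, α l) := by
  convert add_mem
    (Submodule.smul_mem _ a (zMono_zDeriv_commutator_mem_filtration (N := N) 1 α hN))
    (Submodule.smul_mem _ b (zMono_zDeriv_commutator_mem_filtration (N := N) 0 α hN)) using 1
  funext h
  have hreg : ∀ k, IsCkGroup (∑ l, α l) (zDeriv k h.1) :=
    fun k => isCkGroup_zDeriv (h.2.of_le hN) k
  simp only [xOp, Pi.add_apply, Pi.smul_apply, smul_sub, zMono_smul,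
    zMono_add ((hreg 1).smul a) ((hreg 0).smul b)]
  abel

theorem exists_zMono_xOp_commutator_bound (a b : ℂ) (α : Fin 3 → ℕ) : ∃ C : ℝ, 0 ≤ C ∧
    ∀ h, IsCkGroup (∑ l, α l + 1) h → ∀ g,
      ‖zMono α (xOp a b h) g - xOp a b (zMono α h) g‖ ^ 2
        ≤ C * ∑ β ∈ multiIndices (∑ l, α l), ‖zMono β h g‖ ^ 2 := by
  obtain ⟨C, hC, hbound⟩ :=
    exists_bound_of_mem_filtration (zMono_xOp_commutator_mem_filtration a b α le_rfl)
  exact ⟨C, hC, fun h hh => hbound ⟨h, hh⟩⟩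

/-! ### Integration by parts on `SU(2)` -/

instance isHaarMeasure_haarSU2 : haarSU2.IsHaarMeasure := by
  unfold haarSU2; infer_instance

instance isProbabilityMeasure_haarSU2 : IsProbabilityMeasure haarSU2 :=
  ⟨Measure.haarMeasure_self (K₀ := (⊤ : TopologicalSpace.PositiveCompacts SU2))⟩

instance isMulRightInvariant_haarSU2 : haarSU2.IsMulRightInvariant where
  map_mul_right_eq_self g := by
    have : IsProbabilityMeasure (haarSU2.map (· * g)) :=
      Measure.isProbabilityMeasure_map (continuous_mul_const g).aemeasurable
    exact Measure.isHaarMeasure_eq_of_isProbabilityMeasure _ _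

section

variable {h u w : SU2 → ℂ}

theorem hasDerivAt_mul_oneParam (hh : IsCkGroup 1 h) (k : Fin 3) (g : SU2) (t : ℝ) :
    HasDerivAt (fun s : ℝ => h (g * oneParam k s)) (zDeriv k h (g * oneParam k t)) t := by
  have hshift : HasDerivAt (fun s : ℝ => h (g * oneParam k t * oneParam k (s - t)))
      (zDeriv k h (g * oneParam k t)) t :=
    HasDerivAt.comp_sub_const t t (by simpa using hh.hasDerivAt k (g * oneParam k t))
  simpa only [mul_assoc, ← oneParam_add, add_sub_cancel] using hshift

theorem integrable_haarSU2_of_continuous {E : Type*} [NormedAddCommGroup E] {f : SU2 → E}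
    (hf : Continuous f) : Integrable f haarSU2 :=
  hf.integrable_of_hasCompactSupport (HasCompactSupport.of_compactSpace f)

-- Right translation by `exp (t ξₖ)` preserves `∫ h dμ`; differentiate at `t = 0`.
theorem integral_zDeriv (hh : IsCkGroup 1 h) (k : Fin 3) : ∫ g, zDeriv k h g ∂haarSU2 = 0 := by
  have hderiv : Continuous (zDeriv k h) := (isCkGroup_zDeriv (n := 0) hh k).continuous
  obtain ⟨M, hM⟩ := (isCompact_range hderiv).isBounded.exists_norm_le
  have hcomp : ∀ t, Continuous fun g => h (g * oneParam k t) :=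
    fun t => hh.continuous.comp (continuous_mul_const _)
  have hd := (hasDerivAt_integral_of_dominated_loc_of_deriv_le (μ := haarSU2)
    (F := fun (t : ℝ) g => h (g * oneParam k t))
    (F' := fun (t : ℝ) g => zDeriv k h (g * oneParam k t)) (x₀ := (0 : ℝ)) (bound := fun _ => M)
    Filter.univ_mem (.of_forall fun t => (hcomp t).aestronglyMeasurable)
    (integrable_haarSU2_of_continuous (hcomp 0))
    (hderiv.comp (continuous_mul_const _)).aestronglyMeasurable
    (.of_forall fun _ _ _ => hM _ (mem_range_self _)) (integrable_const _)
    (.of_forall fun g t _ => hasDerivAt_mul_oneParam hh k g t)).2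
  simp only [integral_mul_right_eq_self] at hd
  exact hd.unique (hasDerivAt_const _ _)

theorem zDeriv_conj_mul (hu : IsCkGroup 1 u) (hw : IsCkGroup 1 w) (k : Fin 3) (g : SU2) :
    zDeriv k (fun g => starRingEnd ℂ (u g) * w g) g
      = starRingEnd ℂ (zDeriv k u g) * w g + starRingEnd ℂ (u g) * zDeriv k w g := by
  have hconj : HasDerivAt (fun t : ℝ => starRingEnd ℂ (u (g * oneParam k t)))
      (starRingEnd ℂ (zDeriv k u g)) 0 :=
    Complex.conjCLE.toContinuousLinearMap.hasFDerivAt.comp_hasDerivAt 0 (hu.hasDerivAt k g)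
  simpa [oneParam_zero, zDeriv] using (hconj.fun_mul (hw.hasDerivAt k g)).deriv

theorem integral_xOp (a b : ℂ) (hh : IsCkGroup 1 h) : ∫ g, xOp a b h g ∂haarSU2 = 0 := by
  have hi : ∀ k, Integrable (zDeriv k h) haarSU2 := fun k =>
    integrable_haarSU2_of_continuous (isCkGroup_zDeriv (n := 0) hh k).continuous
  simp only [xOp]
  rw [integral_add' ((hi 1).smul a) ((hi 0).smul b)]
  simp only [Pi.smul_apply, integral_smul, integral_zDeriv hh, smul_zero, add_zero]

theorem integral_re_conj_mul_xOp_add (a b : ℂ) (hu : IsCkGroup 1 u) (hw : IsCkGroup 1 w) :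
    ∫ g, ((starRingEnd ℂ (u g) * xOp a b w g).re
      + (starRingEnd ℂ (w g) * xOp (starRingEnd ℂ a) (starRingEnd ℂ b) u g).re) ∂haarSU2 = 0 := by
  have huw : IsCkGroup 1 fun g => starRingEnd ℂ (u g) * w g := IsCk.mul (IsCk.conj hu) hw
  have hre := Complex.reCLM.integral_comp_comm
    (integrable_haarSU2_of_continuous (continuous_xOp (a := a) (b := b) huw))
  rw [integral_xOp a b huw, map_zero] at hre
  rw [← hre]
  congr 1 with g
  simp only [Complex.reCLM_apply, xOp, Pi.add_apply, Pi.smul_apply, zDeriv_conj_mul hu hw,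
    smul_eq_mul, Complex.add_re, Complex.mul_re, Complex.conj_re, Complex.conj_im, Complex.add_im,
    Complex.mul_im]
  ring

end

/-! ### The lower domain -/

/-- The map straightening the lower domain to the rectangle `[-1, -1 + ε] × [0, 1]`. -/
noncomputable def straighten (ρs : ℝ) (w : ℝ × ℝ) : ℝ × ℝ := (w.1, w.2 * edge ρs w.1)

section

variable {ε ρs : ℝ}

theorem straighten_fst (w : ℝ × ℝ) : (straighten ρs w).1 = w.1 := rfl

theorem straighten_snd (w : ℝ × ℝ) : (straighten ρs w).2 = w.2 * edge ρs w.1 := rfl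

theorem edge_pos {τ : ℝ} (hρ : 0 < ρs) (hτ : τ < 1) : 0 < edge ρs τ :=
  div_pos (by linarith) (by linarith)

theorem edge_neg_one (ρs : ℝ) : edge ρs (-1) = ρs := by
  simp only [edge]; ring

theorem edge_mul_one_sub (ρs : ℝ) {τ : ℝ} (hτ : τ < 1) : edge ρs τ * (1 - τ) = 2 * ρs :=
  div_mul_cancel₀ _ (by linarith)

theorem hasDerivAt_edge (ρs : ℝ) {τ : ℝ} (hτ : τ < 1) :
    HasDerivAt (edge ρs) (edge ρs τ / (1 - τ)) τ := by
  refine ((hasDerivAt_const τ (2 * ρs)).fun_div ((hasDerivAt_id τ).const_sub 1)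
    (by simp only [id]; linarith)).congr_deriv ?_
  simp only [edge, id]
  field_simp
  ring

theorem continuousOn_edge (ρs : ℝ) : ContinuousOn (edge ρs) (Iio 1) := fun _ hτ =>
  (hasDerivAt_edge ρs hτ).continuousAt.continuousWithinAt

theorem continuousOn_edge_div (ρs : ℝ) :
    ContinuousOn (fun τ => edge ρs τ / (1 - τ)) (Iio 1) :=
  (continuousOn_edge ρs).div (by fun_prop) fun _ hτ => (sub_pos.mpr hτ).ne'

theorem Icc_subset_Iio_one (hε2 : ε < 2) : Icc (-1) (-1 + ε) ⊆ Iio 1 :=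
  fun _ hτ => lt_of_le_of_lt hτ.2 (by linarith)

theorem straighten_image (hε2 : ε < 2) (hρ : 0 < ρs) :
    straighten ρs '' (Icc (-1) (-1 + ε) ×ˢ Icc 0 1) = region ε ρs := by
  ext ⟨τ, ρ⟩
  constructor
  · rintro ⟨⟨τ', s⟩, ⟨hτ, hs⟩, h⟩
    obtain ⟨rfl, rfl⟩ := Prod.mk.inj h
    have hpos := edge_pos hρ (Icc_subset_Iio_one hε2 hτ)
    exact ⟨hτ.1, hτ.2, mul_nonneg hs.1 hpos.le, mul_le_of_le_one_left hpos.le hs.2⟩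
  · rintro ⟨h₁, h₂, h₃, h₄⟩
    have hpos := edge_pos hρ (Icc_subset_Iio_one hε2 ⟨h₁, h₂⟩)
    exact ⟨(τ, ρ / edge ρs τ), ⟨⟨h₁, h₂⟩, div_nonneg h₃ hpos.le, (div_le_one hpos).mpr h₄⟩,
      Prod.ext rfl (div_mul_cancel₀ _ hpos.ne')⟩

theorem mapsTo_straighten (hε2 : ε < 2) (hρ : 0 < ρs) :
    MapsTo (straighten ρs) (Icc (-1) (-1 + ε) ×ˢ Icc 0 1) (region ε ρs) := by
  rw [← straighten_image hε2 hρ]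
  exact mapsTo_image _ _

theorem mapsTo_straighten_interior (hε2 : ε < 2) (hρ : 0 < ρs) :
    MapsTo (straighten ρs) (Ioo (-1) (-1 + ε) ×ˢ Ioo 0 1) (interior (region ε ρs)) := by
  have hopen : IsOpen {z : ℝ × ℝ | (-1 < z.1 ∧ z.1 < -1 + ε) ∧ 0 < z.2 ∧
      z.2 * (1 - z.1) < 2 * ρs} :=
    ((isOpen_lt continuous_const continuous_fst).inter
      (isOpen_lt continuous_fst continuous_const)).inter
      ((isOpen_lt continuous_const continuous_snd).inter
        (isOpen_lt (continuous_snd.mul (continuous_const.sub continuous_fst)) continuous_const))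
  refine fun w hw => interior_maximal ?_ hopen ?_
  · rintro z ⟨⟨h₁, h₂⟩, h₃, h₄⟩
    exact ⟨h₁.le, h₂.le, h₃.le, (le_div_iff₀ (by linarith)).mpr h₄.le⟩
  · have hlt := Icc_subset_Iio_one hε2 (Ioo_subset_Icc_self hw.1)
    refine ⟨hw.1, mul_pos hw.2.1 (edge_pos hρ hlt), ?_⟩
    change w.2 * edge ρs w.1 * (1 - w.1) < _
    rw [mul_assoc, edge_mul_one_sub ρs hlt]
    exact mul_lt_of_lt_one_left (by linarith) hw.2.2

/-- The derivative of `straighten`. -/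
noncomputable def straightenDeriv (ρs : ℝ) (w : ℝ × ℝ) : ℝ × ℝ →L[ℝ] ℝ × ℝ :=
  (ContinuousLinearMap.fst ℝ ℝ ℝ).prod
    (w.2 • ((edge ρs w.1 / (1 - w.1)) • ContinuousLinearMap.fst ℝ ℝ ℝ)
      + edge ρs w.1 • ContinuousLinearMap.snd ℝ ℝ ℝ)

theorem hasFDerivAt_straighten (ρs : ℝ) {w : ℝ × ℝ} (hw : w.1 < 1) :
    HasFDerivAt (straighten ρs) (straightenDeriv ρs w) w :=
  hasFDerivAt_fst.prodMk
    (hasFDerivAt_snd.fun_mul ((hasDerivAt_edge ρs hw).comp_hasFDerivAt w hasFDerivAt_fst))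

theorem continuousOn_straighten (hε2 : ε < 2) :
    ContinuousOn (straighten ρs) (Icc (-1) (-1 + ε) ×ˢ Icc 0 1) := fun _ hw =>
  (hasFDerivAt_straighten ρs (Icc_subset_Iio_one hε2 hw.1)).continuousAt.continuousWithinAt

theorem isCompact_region (hε2 : ε < 2) (hρ : 0 < ρs) : IsCompact (region ε ρs) := by
  rw [← straighten_image hε2 hρ]
  exact (isCompact_Icc.prod isCompact_Icc).image_of_continuousOn (continuousOn_straighten hε2)

theorem uniqueDiffOn_region (hε : 0 < ε) (hε2 : ε < 2) (hρ : 0 < ρs) :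
    UniqueDiffOn ℝ (region ε ρs) := by
  rw [← straighten_image hε2 hρ]
  refine UniqueDiffOn.image ((uniqueDiffOn_Icc (by linarith)).prod (uniqueDiffOn_Icc one_pos))
    (fun w hw => (hasFDerivAt_straighten ρs
      (Icc_subset_Iio_one hε2 hw.1)).hasFDerivWithinAt) fun w hw => ?_
  have hpos := edge_pos hρ (Icc_subset_Iio_one hε2 hw.1)
  refine Function.Surjective.denseRange fun y =>
    ⟨(y.1, (y.2 - w.2 * (edge ρs w.1 / (1 - w.1) * y.1)) / edge ρs w.1), Prod.ext rfl ?_⟩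
  simp [straightenDeriv, mul_div_cancel₀ _ hpos.ne']

theorem region_subset_closure_interior (hε : 0 < ε) (hε2 : ε < 2) (hρ : 0 < ρs) :
    region ε ρs ⊆ closure (interior (region ε ρs)) := by
  have hclosure : Icc (-1) (-1 + ε) ×ˢ Icc (0 : ℝ) 1 = closure (Ioo (-1) (-1 + ε) ×ˢ Ioo 0 1) := by
    rw [closure_prod_eq, closure_Ioo (by linarith), closure_Ioo zero_ne_one]
  have hcont := continuousOn_straighten (ρs := ρs) hε2
  rw [hclosure] at hcont
  calc region ε ρs = straighten ρs '' closure (Ioo (-1) (-1 + ε) ×ˢ Ioo 0 1) := by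
        rw [← hclosure, straighten_image hε2 hρ]
    _ ⊆ closure (straighten ρs '' (Ioo (-1) (-1 + ε) ×ˢ Ioo 0 1)) := hcont.image_closure
    _ ⊆ closure (interior (region ε ρs)) :=
        closure_mono (mapsTo_straighten_interior hε2 hρ).image_subset

theorem regularRegion_region (hε : 0 < ε) (hε2 : ε < 2) (hρ : 0 < ρs) :
    RegularRegion (region ε ρs) :=
  ⟨uniqueDiffOn_region hε hε2 hρ, region_subset_closure_interior hε hε2 hρ⟩

theorem integral_region (hε : 0 < ε) (hε2 : ε < 2) (hρ : 0 < ρs) {F : ℝ × ℝ → ℝ}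
    (hF : ContinuousOn F (region ε ρs)) :
    ∫ z in region ε ρs, F z
      = ∫ τ in (-1)..(-1 + ε), ∫ s in (0 : ℝ)..1, edge ρs τ * F (straighten ρs (τ, s)) := by
  have hmeas := (isCompact_region hε2 hρ).measurableSet
  have hint := (integrable_indicator_iff hmeas).mpr
    (hF.integrableOn_compact (μ := volume) (isCompact_region hε2 hρ))
  rw [← integral_indicator hmeas, Measure.volume_eq_prod, integral_prod _ hint,
    intervalIntegral.integral_of_le (by linarith), ← integral_Icc_eq_integral_Ioc,
    ← integral_indicator measurableSet_Icc]
  congr 1 with τ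
  by_cases hτ : τ ∈ Icc (-1) (-1 + ε)
  · have hpos := edge_pos hρ (Icc_subset_Iio_one hε2 hτ)
    have hslice : ∀ ρ, (region ε ρs).indicator F (τ, ρ)
        = (Icc 0 (edge ρs τ)).indicator (fun ρ => F (τ, ρ)) ρ := fun ρ =>
      indicator_eq_indicator ⟨fun h => h.2.2, fun h => ⟨hτ.1, hτ.2, h.1, h.2⟩⟩ rfl
    simp only [hslice, indicator_of_mem hτ, straighten]
    rw [integral_indicator measurableSet_Icc, integral_Icc_eq_integral_Ioc,
      ← intervalIntegral.integral_of_le hpos.le, intervalIntegral.integral_const_mul,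
      intervalIntegral.mul_integral_comp_mul_right (f := fun ρ => F (τ, ρ)), zero_mul, one_mul]
  · have hslice : ∀ ρ, (region ε ρs).indicator F (τ, ρ) = 0 := fun ρ =>
      indicator_of_notMem (fun h => hτ ⟨h.1, h.2.1⟩) F
    simp only [hslice, integral_zero, indicator_of_notMem hτ]

/-- The derivative of `h` along the field `(1 + d τ) ∂_τ - d ρ ∂_ρ`, one-sided at the boundary
of `K`. The incoming null field is the case `d = 1` and the outgoing one the case `d = -1`. -/
noncomputable def nullDeriv (K : Set (ℝ × ℝ)) (d : ℝ) (h : ℝ × ℝ → ℝ) (z : ℝ × ℝ) : ℝ :=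
  (1 + d * z.1) * fderivWithin ℝ h K z (1, 0) - d * z.2 * fderivWithin ℝ h K z (0, 1)

theorem continuousOn_nullDeriv {K : Set (ℝ × ℝ)} (hK : UniqueDiffOn ℝ K) (d : ℝ) {h : ℝ × ℝ → ℝ}
    (hh : ContDiffOn ℝ 1 h K) : ContinuousOn (nullDeriv K d h) K := by
  have hderiv := hh.continuousOn_fderivWithin hK le_rfl
  exact ((by fun_prop : Continuous fun z : ℝ × ℝ => 1 + d * z.1).continuousOn.mul
    (hderiv.clm_apply continuousOn_const)).sub
    ((by fun_prop : Continuous fun z : ℝ × ℝ => d * z.2).continuousOn.mul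
      (hderiv.clm_apply continuousOn_const))

theorem hasFDerivAt_comp_straighten (hε2 : ε < 2) (hρ : 0 < ρs) {h : ℝ × ℝ → ℝ}
    (hh : DifferentiableOn ℝ h (region ε ρs)) {w : ℝ × ℝ}
    (hw : w ∈ Ioo (-1) (-1 + ε) ×ˢ Ioo (0 : ℝ) 1) :
    HasFDerivAt (fun w => h (straighten ρs w))
      ((fderivWithin ℝ h (region ε ρs) (straighten ρs w)).comp (straightenDeriv ρs w)) w := by
  have hz := mapsTo_straighten_interior hε2 hρ hw
  exact ((hh _ (interior_subset hz)).hasFDerivWithinAt.hasFDerivAt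
    (mem_interior_iff_mem_nhds.mp hz)).comp w
    (hasFDerivAt_straighten ρs (Icc_subset_Iio_one hε2 (Ioo_subset_Icc_self hw.1)))

theorem hasFDerivAt_time_coeff (d ρs : ℝ) {w : ℝ × ℝ} (hw : w.1 < 1) :
    HasFDerivAt (fun w : ℝ × ℝ => (1 + d * w.1) * edge ρs w.1)
      ((d * edge ρs w.1 + (1 + d * w.1) * (edge ρs w.1 / (1 - w.1))) •
        ContinuousLinearMap.fst ℝ ℝ ℝ) w :=
  (((((hasDerivAt_id w.1).const_mul d).const_add 1).fun_mul (hasDerivAt_edge ρs hw)).congr_deriv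
    (by simp)).comp_hasFDerivAt w hasFDerivAt_fst

theorem hasFDerivAt_side_coeff (d ρs : ℝ) {w : ℝ × ℝ} (hw : w.1 < 1) :
    HasFDerivAt (fun w : ℝ × ℝ => -(1 + d) * (edge ρs w.1 / (1 - w.1)) * w.2)
      ((-(1 + d) * (edge ρs w.1 / (1 - w.1))) • ContinuousLinearMap.snd ℝ ℝ ℝ
        + w.2 • ((-(1 + d) * (2 * edge ρs w.1 / (1 - w.1) ^ 2)) •
          ContinuousLinearMap.fst ℝ ℝ ℝ)) w := by
  have hne : 1 - w.1 ≠ 0 := by linarith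
  have hderiv : HasDerivAt (fun τ => -(1 + d) * (edge ρs τ / (1 - τ)))
      (-(1 + d) * (2 * edge ρs w.1 / (1 - w.1) ^ 2)) w.1 := by
    refine (((hasDerivAt_edge ρs hw).fun_div ((hasDerivAt_id w.1).const_sub 1) hne).const_mul
      _).congr_deriv ?_
    simp only [id]
    field_simp
    ring
  exact (hderiv.comp_hasFDerivAt w hasFDerivAt_fst).fun_mul hasFDerivAt_snd

/-- The flux of `h` times the field of `nullDeriv` in the `τ`-direction, in straightened
coordinates. -/
noncomputable def timeFlux (d ρs : ℝ) (h : ℝ × ℝ → ℝ) (w : ℝ × ℝ) : ℝ :=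
  (1 + d * w.1) * edge ρs w.1 * h (straighten ρs w)

/-- The flux of `h` times the field of `nullDeriv` in the radial direction, in straightened
coordinates. -/
noncomputable def sideFlux (d ρs : ℝ) (h : ℝ × ℝ → ℝ) (w : ℝ × ℝ) : ℝ :=
  -(1 + d) * (edge ρs w.1 / (1 - w.1)) * w.2 * h (straighten ρs w)

theorem exists_hasFDerivAt_flux (hε2 : ε < 2) (hρ : 0 < ρs) (d : ℝ) {h : ℝ × ℝ → ℝ}
    (hh : DifferentiableOn ℝ h (region ε ρs)) :
    ∃ f' g' : ℝ × ℝ → ℝ × ℝ →L[ℝ] ℝ,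
      (∀ w ∈ Ioo (-1) (-1 + ε) ×ˢ Ioo (0 : ℝ) 1,
        HasFDerivAt (timeFlux d ρs h) (f' w) w ∧ HasFDerivAt (sideFlux d ρs h) (g' w) w) ∧
      ∀ w ∈ Icc (-1) (-1 + ε) ×ˢ Icc (0 : ℝ) 1, f' w (1, 0) + g' w (0, 1)
        = edge ρs w.1 * nullDeriv (region ε ρs) d h (straighten ρs w) := by
  have hlt : ∀ w ∈ Ioo (-1) (-1 + ε) ×ˢ Ioo (0 : ℝ) 1, w.1 < 1 := fun w hw =>
    Icc_subset_Iio_one hε2 (Ioo_subset_Icc_self hw.1)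
  have htime := fun w hw =>
    (hasFDerivAt_time_coeff d ρs (hlt w hw)).fun_mul (hasFDerivAt_comp_straighten hε2 hρ hh hw)
  have hside := fun w hw =>
    (hasFDerivAt_side_coeff d ρs (hlt w hw)).fun_mul (hasFDerivAt_comp_straighten hε2 hρ hh hw)
  refine ⟨_, _, fun w hw => ⟨htime w hw, hside w hw⟩, fun w hw => ?_⟩
  have hne : 1 - w.1 ≠ 0 := (sub_pos.mpr (Icc_subset_Iio_one hε2 hw.1)).ne'
  set L := fderivWithin ℝ h (region ε ρs) (straighten ρs w) with hL
  have happly : ∀ x y : ℝ, L (x, y) = x * L (1, 0) + y * L (0, 1) := fun x y => by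
    rw [← smul_eq_mul, ← smul_eq_mul, ← map_smul, ← map_smul, ← map_add]
    simp
  simp only [straightenDeriv, add_apply, smul_apply, ContinuousLinearMap.comp_apply,
    ContinuousLinearMap.prod_apply, ContinuousLinearMap.coe_fst', smul_eq_mul, mul_one,
    ContinuousLinearMap.coe_snd', mul_zero, add_zero, happly _ (w.2 * _), one_mul, neg_add_rev,
    smul_add, zero_add, happly _ (edge ρs w.1), zero_mul, nullDeriv, straighten_fst, ← hL,
    straighten_snd]
  field_simp
  ring

theorem integral_nullDeriv (hε : 0 < ε) (hε2 : ε < 2) (hρ : 0 < ρs) (d : ℝ) {h : ℝ × ℝ → ℝ}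
    (hh : ContDiffOn ℝ 1 h (region ε ρs)) :
    ∫ z in region ε ρs, nullDeriv (region ε ρs) d h z
      = (∫ τ in (-1)..(-1 + ε), sideFlux d ρs h (τ, 1))
        - (∫ τ in (-1)..(-1 + ε), sideFlux d ρs h (τ, 0))
        + (∫ s in (0 : ℝ)..1, timeFlux d ρs h (-1 + ε, s))
        - ∫ s in (0 : ℝ)..1, timeFlux d ρs h (-1, s) := by
  obtain ⟨f', g', hderiv, hdiv⟩ :=
    exists_hasFDerivAt_flux hε2 hρ d (hh.differentiableOn one_ne_zero)
  have hle : (-1 : ℝ) ≤ -1 + ε := by linarith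
  have hV := continuousOn_nullDeriv (uniqueDiffOn_region hε hε2 hρ) d hh
  have hS := continuousOn_straighten (ρs := ρs) hε2
  have hh' := hh.continuousOn.comp hS (mapsTo_straighten hε2 hρ)
  have hfst : MapsTo Prod.fst (Icc (-1) (-1 + ε) ×ˢ Icc (0 : ℝ) 1) (Iio 1) :=
    fun w hw => Icc_subset_Iio_one hε2 hw.1
  have hedge := (continuousOn_edge ρs).comp continuousOn_fst hfst
  have hedge' := (continuousOn_edge_div ρs).comp continuousOn_fst hfst
  rw [integral_region hε hε2 hρ hV, ← integral2_divergence_prod_of_hasFDerivAt _ _ f' g']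
  · refine intervalIntegral.integral_congr fun τ hτ =>
      intervalIntegral.integral_congr fun s hs => ?_
    rw [uIcc_of_le hle] at hτ
    rw [uIcc_of_le zero_le_one] at hs
    exact (hdiv (τ, s) ⟨hτ, hs⟩).symm
  all_goals simp only [uIcc_of_le, min_eq_left, max_eq_right, hle, zero_le_one]
  · exact (((by fun_prop : Continuous fun w : ℝ × ℝ => 1 + d * w.1).continuousOn.mul hedge).mul hh')
  · exact ((continuousOn_const.mul hedge').mul continuousOn_snd).mul hh'
  · exact fun w hw => (hderiv w hw).1
  · exact fun w hw => (hderiv w hw).2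
  · exact ((hedge.mul (hV.comp hS (mapsTo_straighten hε2 hρ))).congr hdiv).integrableOn_compact
      (isCompact_Icc.prod isCompact_Icc)

theorem neg_boundary_integrals_le_integral_nullDeriv (hε : 0 < ε) (hε2 : ε < 2) (hρ : 0 < ρs)
    {d : ℝ} (hd : |d| ≤ 1) {h : ℝ × ℝ → ℝ} (hh : ContDiffOn ℝ 1 h (region ε ρs))
    (h0 : ∀ z ∈ region ε ρs, 0 ≤ h z) :
    -((1 - d) * (∫ ρ in Icc 0 ρs, h (-1, ρ))
        + (1 + d) * ∫ τ in Icc (-1) (-1 + ε), edge ρs τ / (1 - τ) * h (τ, edge ρs τ))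
      ≤ ∫ z in region ε ρs, nullDeriv (region ε ρs) d h z := by
  have hle : (-1 : ℝ) ≤ -1 + ε := by linarith
  have hfinal : 0 ≤ ∫ s in (0 : ℝ)..1, timeFlux d ρs h (-1 + ε, s) := by
    refine intervalIntegral.integral_nonneg zero_le_one fun s hs => ?_
    have hcoeff : 0 ≤ 1 + d * (-1 + ε) := by
      nlinarith [abs_le.mp hd]
    exact mul_nonneg (mul_nonneg hcoeff (edge_pos hρ (by linarith)).le)
      (h0 _ (mapsTo_straighten hε2 hρ ⟨right_mem_Icc.mpr hle, hs⟩))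
  have hscri : ∫ s in (0 : ℝ)..1, timeFlux d ρs h (-1, s)
      = (1 - d) * ∫ ρ in Icc 0 ρs, h (-1, ρ) := by
    simp only [timeFlux, straighten, edge_neg_one, mul_assoc, intervalIntegral.integral_const_mul]
    rw [intervalIntegral.mul_integral_comp_mul_right (f := fun ρ => h (-1, ρ)), zero_mul, one_mul,
      intervalIntegral.integral_of_le hρ.le, integral_Icc_eq_integral_Ioc]
    ring
  have hedge : ∫ τ in (-1)..(-1 + ε), sideFlux d ρs h (τ, 1)
      = -(1 + d) * ∫ τ in Icc (-1) (-1 + ε), edge ρs τ / (1 - τ) * h (τ, edge ρs τ) := by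
    simp only [sideFlux, straighten, mul_one, one_mul, mul_assoc,
      intervalIntegral.integral_const_mul]
    rw [intervalIntegral.integral_of_le hle, integral_Icc_eq_integral_Ioc]
  have haxis : ∫ τ in (-1)..(-1 + ε), sideFlux d ρs h (τ, 0) = 0 := by
    simp [sideFlux]
  rw [integral_nullDeriv hε hε2 hρ d hh, hscri, hedge, haxis]
  linarith

end

/-! ### The energy inequality -/

instance secondCountableTopology_SU2 : SecondCountableTopology SU2 := by
  have : SecondCountableTopology (Matrix (Fin 2) (Fin 2) ℂ) :=
    inferInstanceAs (SecondCountableTopology (Fin 2 → Fin 2 → ℂ))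
  exact TopologicalSpace.Subtype.secondCountableTopology _

theorem integrable_prod_haarSU2 {Y : Type*} [TopologicalSpace Y] [MeasurableSpace Y]
    [BorelSpace Y] [T2Space Y] [SecondCountableTopology Y] {μ : Measure Y}
    [IsFiniteMeasureOnCompacts μ] [SFinite μ] {t : Set Y} (ht : IsCompact t) {φ : Y × SU2 → ℝ}
    (hφ : ContinuousOn φ (t ×ˢ Set.univ)) : Integrable φ ((μ.restrict t).prod haarSU2) := by
  have h := hφ.integrableOn_compact (μ := μ.prod haarSU2) (ht.prod isCompact_univ)
  rwa [IntegrableOn, ← Measure.prod_restrict, Measure.restrict_univ] at h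

section Energy

variable {ι : Type*} {s : Finset ι} {K : Set (ℝ × ℝ)} {u w : ι → Field} {n : ℕ}

/-- The sum of the squares of a finite family of fields. -/
noncomputable def energy (s : Finset ι) (u : ι → Field) (z : ℝ × ℝ) (g : SU2) : ℝ :=
  ∑ i ∈ s, ‖u i z g‖ ^ 2

theorem energy_nonneg (u : ι → Field) (z : ℝ × ℝ) (g : SU2) : 0 ≤ energy s u z g :=
  Finset.sum_nonneg fun _ _ => sq_nonneg _

theorem continuousOn_energy (hu : ∀ i ∈ s, IsCk n K (u i)) :
    ContinuousOn (fun x : (ℝ × ℝ) × SU2 => energy s u x.1 x.2) (K ×ˢ Set.univ) :=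
  continuousOn_finsetSum _ fun i hi => ((hu i hi).continuousOn.norm).pow 2

theorem continuousOn_energy_comp {Y : Type*} [TopologicalSpace Y]
    (hu : ∀ i ∈ s, IsCk n K (u i)) {γ : Y → ℝ × ℝ} {t : Set Y} (hγ : ContinuousOn γ t)
    (hmaps : MapsTo γ t K) :
    ContinuousOn (fun x : Y × SU2 => energy s u (γ x.1) x.2) (t ×ˢ Set.univ) :=
  (continuousOn_energy hu).comp (f := fun x : Y × SU2 => (γ x.1, x.2))
    ((hγ.comp continuousOn_fst fun _ hx => hx.1).prodMk continuousOn_snd)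
    fun _ hx => mk_mem_prod (hmaps hx.1) (mem_univ _)

theorem continuous_energy (hu : ∀ i ∈ s, IsCk n K (u i)) {z : ℝ × ℝ} (hz : z ∈ K) :
    Continuous (energy s u z) :=
  continuous_finsetSum _ fun i hi => ((hu i hi).continuous_fiber hz).norm.pow 2

theorem contDiffOn_energy (hu : ∀ i ∈ s, IsCk n K (u i)) (g : SU2) :
    ContDiffOn ℝ n (fun z => energy s u z g) K :=
  ContDiffOn.sum fun i hi => ((hu i hi).slice g).norm_sq ℝ

theorem fderivWithin_energy (hK : UniqueDiffOn ℝ K) (hu : ∀ i ∈ s, IsCk 1 K (u i)) {z : ℝ × ℝ}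
    (hz : z ∈ K) (g : SU2) (y : ℝ × ℝ) :
    fderivWithin ℝ (fun z => energy s u z g) K z y
      = ∑ i ∈ s, 2 * (starRingEnd ℂ (u i z g) * fderivWithin ℝ (fun w => u i w g) K z y).re := by
  have h : HasFDerivWithinAt (fun z => energy s u z g) _ K z :=
    HasFDerivWithinAt.fun_sum fun i hi =>
      ((hu i hi).differentiableWithinAt hz g).hasFDerivWithinAt.norm_sq
  rw [h.fderivWithin (hK z hz)]
  simp [Complex.inner, mul_comm, mul_add]

/-- The derivative of the energy along `(1 + d τ) ∂_τ - d ρ ∂_ρ`, see `nullDeriv_energy`. -/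
noncomputable def energyFlux (K : Set (ℝ × ℝ)) (s : Finset ι) (d : ℝ) (u : ι → Field)
    (z : ℝ × ℝ) (g : SU2) : ℝ :=
  ∑ i ∈ s, 2 * (starRingEnd ℂ (u i z g) * transport K 1 d (-d) (u i) z g).re

theorem nullDeriv_energy (hK : UniqueDiffOn ℝ K) (hu : ∀ i ∈ s, IsCk 1 K (u i)) (d : ℝ)
    {z : ℝ × ℝ} (hz : z ∈ K) (g : SU2) :
    nullDeriv K d (fun z => energy s u z g) z = energyFlux K s d u z g := by
  rw [nullDeriv, fderivWithin_energy hK hu hz, fderivWithin_energy hK hu hz, Finset.mul_sum,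
    Finset.mul_sum, ← Finset.sum_sub_distrib]
  refine Finset.sum_congr rfl fun i _ => ?_
  simp only [transport, dTau, dRho, Pi.add_apply, Pi.smul_apply, mul_add, mul_smul_comm,
    Complex.add_re, Complex.smul_re, smul_eq_mul]
  ring

theorem continuousOn_energyFlux (hK : RegularRegion K) (hu : ∀ i ∈ s, IsCk 1 K (u i)) (d : ℝ) :
    ContinuousOn (fun x : (ℝ × ℝ) × SU2 => energyFlux K s d u x.1 x.2) (K ×ˢ Set.univ) :=
  continuousOn_finsetSum _ fun i hi => continuousOn_const.mul
    (Complex.continuous_re.comp_continuousOn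
      ((Complex.continuous_conj.comp_continuousOn (hu i hi).continuousOn).mul
        (((isVectorField_transport hK 1 d (-d)).firstOrder hK).isCk (n := 0)
          (hu i hi)).continuousOn))

theorem continuous_energyFlux (hK : RegularRegion K) (hu : ∀ i ∈ s, IsCk 1 K (u i)) (d : ℝ)
    {z : ℝ × ℝ} (hz : z ∈ K) : Continuous (energyFlux K s d u z) :=
  (continuousOn_energyFlux hK hu d).comp_continuous (f := fun g : SU2 => (z, g))
    (continuous_const.prodMk continuous_id) fun _ => ⟨hz, mem_univ _⟩

theorem two_mul_re_conj_mul_le (x y : ℂ) {δ : ℝ} (hδ : 0 < δ) :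
    2 * (starRingEnd ℂ x * y).re ≤ δ * ‖x‖ ^ 2 + δ⁻¹ * ‖y‖ ^ 2 := by
  have hre : (starRingEnd ℂ x * y).re ≤ ‖x‖ * ‖y‖ := by
    refine (Complex.re_le_norm _).trans_eq ?_
    rw [norm_mul, Complex.norm_conj]
  have hsq : δ * ‖x‖ ^ 2 + δ⁻¹ * ‖y‖ ^ 2 - 2 * (‖x‖ * ‖y‖) = δ⁻¹ * (δ * ‖x‖ - ‖y‖) ^ 2 := by
    field_simp
    ring
  have hsq0 : 0 ≤ δ⁻¹ * (δ * ‖x‖ - ‖y‖) ^ 2 := by positivity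
  linarith

theorem re_conj_mul_self (x : ℂ) : (starRingEnd ℂ x * x).re = ‖x‖ ^ 2 := by
  rw [Complex.conj_mul', ← Complex.ofReal_pow, Complex.ofReal_re]

-- The coefficient `a ≥ 1` leaves a negative multiple of `‖x‖ ^ 2` after absorbing the
-- perturbation `c`.
theorem flux_pair_le (x y X Y c e : ℂ) {a A δ : ℝ} (ha : 1 ≤ a) (haA : a ≤ A) (hδ : 0 < δ) :
    2 * (starRingEnd ℂ x * (X + c - a • x)).re
        + 2 * (starRingEnd ℂ y * (Y + e - (-1 - a) • y)).re
      ≤ 2 * ((starRingEnd ℂ x * X).re + (starRingEnd ℂ y * Y).re)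
        + (-(3 / 2) * ‖x‖ ^ 2 + (2 * (1 + A) + δ) * ‖y‖ ^ 2
          + (2 * ‖c‖ ^ 2 + δ⁻¹ * ‖e‖ ^ 2)) := by
  have hc := two_mul_re_conj_mul_le x c (one_half_pos (α := ℝ))
  have he := two_mul_re_conj_mul_le y e hδ
  have hx : 1 * ‖x‖ ^ 2 ≤ a * ‖x‖ ^ 2 := by gcongr
  have hy : a * ‖y‖ ^ 2 ≤ A * ‖y‖ ^ 2 := by gcongr
  simp only [mul_sub, mul_add, mul_smul_comm, Complex.sub_re, Complex.add_re, Complex.smul_re,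
    smul_eq_mul, re_conj_mul_self]
  rw [one_div, inv_inv] at hc
  linarith

/-- The constant in the energy inequality, for commutator terms bounded by `B`, a family of `n`
fields and lower order coefficients bounded by `A`. -/
noncomputable def energyConst (n : ℕ) (A B : ℝ) : ℝ := 4 * (n * B) + 2 * A + 4

/-- The coupled transport system for the families `u` and `w` to which the energy method applies:
`u` is transported along the incoming and `w` along the outgoing null field, the angular couplings
are mutually skew-adjoint, and the perturbations `c` and `e` are bounded by the energies. -/
structure CoupledTransport (K : Set (ℝ × ℝ)) (s : Finset ι) (x y : ℂ) (A B : ℝ) (a : ι → ℝ)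
    (u w c e : ι → Field) : Prop where
  one_le : ∀ i ∈ s, 1 ≤ a i
  le_bound : ∀ i ∈ s, a i ≤ A
  incoming : ∀ i ∈ s, Transports K 1 1 (-1) (a i) (u i) (xField x y (w i) + c i)
  outgoing : ∀ i ∈ s, Transports K 1 (-1) 1 (-1 - a i) (w i)
    (xField (starRingEnd ℂ x) (starRingEnd ℂ y) (u i) + e i)
  incoming_error : ∀ i ∈ s, ∀ z ∈ K, ∀ g, ‖c i z g‖ ^ 2 ≤ B * energy s w z g
  outgoing_error : ∀ i ∈ s, ∀ z ∈ K, ∀ g, ‖e i z g‖ ^ 2 ≤ B * energy s u z g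

/-- The density of the angular coupling in the energy balance, which integrates to zero over
`SU(2)`. -/
noncomputable def angularCoupling (s : Finset ι) (x y : ℂ) (u w : ι → Field) (z : ℝ × ℝ)
    (g : SU2) : ℝ :=
  ∑ i ∈ s, ((starRingEnd ℂ (u i z g) * xOp x y (w i z) g).re
    + (starRingEnd ℂ (w i z g) * xOp (starRingEnd ℂ x) (starRingEnd ℂ y) (u i z) g).re)

variable {x y : ℂ} {A B : ℝ} {a : ι → ℝ} {c e : ι → Field}

theorem CoupledTransport.flux_term_le (H : CoupledTransport K s x y A B a u w c e) {i : ι}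
    (hi : i ∈ s) {δ : ℝ} (hδ : 0 < δ) {z : ℝ × ℝ} (hz : z ∈ K) (g : SU2) :
    2 * (starRingEnd ℂ (u i z g) * transport K 1 1 (-1) (u i) z g).re
        + 2 * (starRingEnd ℂ (w i z g) * transport K 1 (-1) 1 (w i) z g).re
      ≤ 2 * ((starRingEnd ℂ (u i z g) * xOp x y (w i z) g).re
          + (starRingEnd ℂ (w i z g) * xOp (starRingEnd ℂ x) (starRingEnd ℂ y) (u i z) g).re)
        + (-(3 / 2) * ‖u i z g‖ ^ 2 + (2 * (1 + A) + δ) * ‖w i z g‖ ^ 2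
          + (2 * (B * energy s w z g) + δ⁻¹ * (B * energy s u z g))) := by
  have hu : transport K 1 1 (-1) (u i) z g = xOp x y (w i z) g + c i z g - a i • u i z g :=
    eq_sub_of_add_eq (congrFun (H.incoming i hi hz) g)
  have hw : transport K 1 (-1) 1 (w i) z g
      = xOp (starRingEnd ℂ x) (starRingEnd ℂ y) (u i z) g + e i z g - (-1 - a i) • w i z g :=
    eq_sub_of_add_eq (congrFun (H.outgoing i hi hz) g)
  rw [hu, hw]
  refine (flux_pair_le _ _ _ _ _ _ (H.one_le i hi) (H.le_bound i hi) hδ).trans ?_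
  gcongr
  · exact H.incoming_error i hi z hz g
  · exact H.outgoing_error i hi z hz g

theorem CoupledTransport.energyFlux_add_le (H : CoupledTransport K s x y A B a u w c e)
    (hB : 0 ≤ B) {z : ℝ × ℝ} (hz : z ∈ K) (g : SU2) :
    energyFlux K s 1 u z g + energyFlux K s (-1) w z g
      ≤ 2 * angularCoupling s x y u w z g - energy s u z g
        + energyConst s.card A B * energy s w z g := by
  set δ : ℝ := 2 * (s.card * B + 1) with hδ
  have hδ0 : 0 < δ := by positivity
  have hsum := Finset.sum_le_sum fun i hi => H.flux_term_le hi hδ0 hz g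
  simp only [Finset.sum_add_distrib, ← Finset.mul_sum, Finset.sum_const, nsmul_eq_mul] at hsum
  have habsorb : s.card * (δ⁻¹ * (B * energy s u z g)) ≤ 1 / 2 * energy s u z g := by
    calc s.card * (δ⁻¹ * (B * energy s u z g)) = s.card * B / δ * energy s u z g := by
          field_simp
      _ ≤ 1 / 2 * energy s u z g := by
          refine mul_le_mul_of_nonneg_right ?_ (energy_nonneg u z g)
          rw [div_le_iff₀ hδ0]
          linarith
  simp only [energyFlux, angularCoupling, energyConst, neg_neg, Finset.sum_add_distrib,
    ← Finset.mul_sum]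
  refine hsum.trans ?_
  change _ + (-(3 / 2) * energy s u z g + (2 * (1 + A) + δ) * energy s w z g + _) ≤ _
  rw [hδ] at habsorb ⊢
  linarith [habsorb]

theorem continuous_re_conj_mul_xOp_add {h k : SU2 → ℂ} (hh : IsCkGroup 1 h)
    (hk : IsCkGroup 1 k) :
    Continuous fun g => (starRingEnd ℂ (h g) * xOp x y k g).re
      + (starRingEnd ℂ (k g) * xOp (starRingEnd ℂ x) (starRingEnd ℂ y) h g).re :=
  (Complex.continuous_re.comp
      ((Complex.continuous_conj.comp hh.continuous).mul (continuous_xOp hk))).add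
    (Complex.continuous_re.comp
      ((Complex.continuous_conj.comp hk.continuous).mul (continuous_xOp hh)))

theorem continuous_angularCoupling (hu : ∀ i ∈ s, IsCk 1 K (u i)) (hw : ∀ i ∈ s, IsCk 1 K (w i))
    {z : ℝ × ℝ} (hz : z ∈ K) : Continuous (angularCoupling s x y u w z) :=
  continuous_finsetSum _ fun i hi =>
    continuous_re_conj_mul_xOp_add ((hu i hi).fiber hz) ((hw i hi).fiber hz)

theorem integral_angularCoupling (hu : ∀ i ∈ s, IsCk 1 K (u i)) (hw : ∀ i ∈ s, IsCk 1 K (w i))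
    {z : ℝ × ℝ} (hz : z ∈ K) : ∫ g, angularCoupling s x y u w z g ∂haarSU2 = 0 := by
  simp only [angularCoupling]
  rw [integral_finsetSum _ fun i hi => integrable_haarSU2_of_continuous
    (continuous_re_conj_mul_xOp_add ((hu i hi).fiber hz) ((hw i hi).fiber hz))]
  exact Finset.sum_eq_zero fun i hi =>
    integral_re_conj_mul_xOp_add x y ((hu i hi).fiber hz) ((hw i hi).fiber hz)

theorem CoupledTransport.integral_energyFlux_add_le
    (H : CoupledTransport K s x y A B a u w c e) (hK : RegularRegion K) (hB : 0 ≤ B)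
    (hu : ∀ i ∈ s, IsCk 1 K (u i)) (hw : ∀ i ∈ s, IsCk 1 K (w i)) {z : ℝ × ℝ} (hz : z ∈ K) :
    (∫ g, energyFlux K s 1 u z g ∂haarSU2) + ∫ g, energyFlux K s (-1) w z g ∂haarSU2
      ≤ -(∫ g, energy s u z g ∂haarSU2)
        + energyConst s.card A B * ∫ g, energy s w z g ∂haarSU2 := by
  have hFu := integrable_haarSU2_of_continuous (continuous_energyFlux hK hu 1 hz)
  have hFw := integrable_haarSU2_of_continuous (continuous_energyFlux hK hw (-1) hz)
  have hR := (integrable_haarSU2_of_continuous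
    (continuous_angularCoupling (x := x) (y := y) hu hw hz)).const_mul 2
  have hEu := integrable_haarSU2_of_continuous (continuous_energy hu hz)
  have hEw := (integrable_haarSU2_of_continuous (continuous_energy hw hz)).const_mul
    (energyConst s.card A B)
  have hmono := integral_mono (hFu.add hFw) ((hR.sub hEu).add hEw)
    fun g => H.energyFlux_add_le hB hz g
  rw [integral_add' hFu hFw, integral_add' (hR.sub hEu) hEw, integral_sub' hR hEu,
    integral_const_mul, integral_const_mul, integral_angularCoupling hu hw hz] at hmono
  linarith

theorem CoupledTransport.setIntegral_energyFlux_add_le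
    (H : CoupledTransport K s x y A B a u w c e) (hK : RegularRegion K) (hKc : IsCompact K)
    (hB : 0 ≤ B) (hu : ∀ i ∈ s, IsCk 1 K (u i)) (hw : ∀ i ∈ s, IsCk 1 K (w i)) :
    (∫ z in K, ∫ g, energyFlux K s 1 u z g ∂haarSU2)
        + ∫ z in K, ∫ g, energyFlux K s (-1) w z g ∂haarSU2
      ≤ -(∫ z in K, ∫ g, energy s u z g ∂haarSU2)
        + energyConst s.card A B * ∫ z in K, ∫ g, energy s w z g ∂haarSU2 := by
  have hint : ∀ {φ : ℝ × ℝ → SU2 → ℝ},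
      ContinuousOn (fun x : (ℝ × ℝ) × SU2 => φ x.1 x.2) (K ×ˢ Set.univ) →
      IntegrableOn (fun z => ∫ g, φ z g ∂haarSU2) K := fun hφ =>
    (integrable_prod_haarSU2 (μ := volume) hKc hφ).integral_prod_left
  have hFu := hint (continuousOn_energyFlux hK hu 1)
  have hFw := hint (continuousOn_energyFlux hK hw (-1))
  have hEu : IntegrableOn (fun z => -∫ g, energy s u z g ∂haarSU2) K :=
    (hint (continuousOn_energy hu)).neg
  have hEw := (hint (continuousOn_energy hw)).const_mul (energyConst s.card A B)
  rw [← integral_add hFu hFw, ← integral_neg, ← integral_const_mul, ← integral_add hEu hEw]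
  exact setIntegral_mono_on (hFu.add hFw) (hEu.add hEw) hKc.measurableSet
    fun z hz => H.integral_energyFlux_add_le hK hB hu hw hz

end Energy

section EnergyInequality

variable {ι : Type*} {s : Finset ι} {ε ρs : ℝ} {u w : ι → Field}

theorem mapsTo_edge (hε2 : ε < 2) (hρ : 0 < ρs) :
    MapsTo (fun τ => (τ, edge ρs τ)) (Icc (-1) (-1 + ε)) (region ε ρs) := fun _ hτ =>
  ⟨hτ.1, hτ.2, (edge_pos hρ (Icc_subset_Iio_one hε2 hτ)).le, le_rfl⟩

theorem mapsTo_scri (hε : 0 < ε) :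
    MapsTo (fun ρ => ((-1 : ℝ), ρ)) (Icc 0 ρs) (region ε ρs) := fun _ hρ' =>
  ⟨le_rfl, by linarith, hρ'.1, by rw [edge_neg_one]; exact hρ'.2⟩

theorem continuousOn_edge_curve (hε2 : ε < 2) :
    ContinuousOn (fun τ => (τ, edge ρs τ)) (Icc (-1) (-1 + ε)) :=
  continuousOn_id.prodMk ((continuousOn_edge ρs).mono (Icc_subset_Iio_one hε2))

theorem neg_boundary_energies_le_integral_energyFlux (hε : 0 < ε) (hε2 : ε < 2) (hρ : 0 < ρs)
    {d : ℝ} (hd : |d| ≤ 1) (hu : ∀ i ∈ s, IsCk 1 (region ε ρs) (u i)) :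
    -((1 - d) * (∫ ρ in Icc 0 ρs, ∫ g, energy s u (-1, ρ) g ∂haarSU2)
        + (1 + d) * ∫ τ in Icc (-1) (-1 + ε),
          edge ρs τ / (1 - τ) * ∫ g, energy s u (τ, edge ρs τ) g ∂haarSU2)
      ≤ ∫ z in region ε ρs, ∫ g, energyFlux (region ε ρs) s d u z g ∂haarSU2 := by
  have hK := regularRegion_region hε hε2 hρ
  have hKc := isCompact_region hε2 hρ
  have hscri : Integrable (fun x : ℝ × SU2 => energy s u (-1, x.1) x.2)
      ((volume.restrict (Icc 0 ρs)).prod haarSU2) :=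
    integrable_prod_haarSU2 isCompact_Icc (continuousOn_energy_comp hu
      (Continuous.prodMk_right (-1)).continuousOn (mapsTo_scri hε))
  have hcoeff : ContinuousOn (fun x : ℝ × SU2 => edge ρs x.1 / (1 - x.1))
      (Icc (-1) (-1 + ε) ×ˢ Set.univ) :=
    ((continuousOn_edge_div ρs).mono (Icc_subset_Iio_one hε2)).comp
      (f := (Prod.fst : ℝ × SU2 → ℝ)) continuousOn_fst fun _ hx => hx.1
  have henergy := continuousOn_energy_comp hu (continuousOn_edge_curve hε2) (mapsTo_edge hε2 hρ)
  have hedge : Integrable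
      (fun x : ℝ × SU2 => edge ρs x.1 / (1 - x.1) * energy s u (x.1, edge ρs x.1) x.2)
      ((volume.restrict (Icc (-1) (-1 + ε))).prod haarSU2) :=
    integrable_prod_haarSU2 isCompact_Icc (hcoeff.mul henergy)
  have hflux := integrable_prod_haarSU2 (μ := volume) hKc (continuousOn_energyFlux hK hu d)
  simp only [← integral_const_mul (edge _ _ / _)]
  rw [integral_integral_swap (f := fun ρ g => energy s u (-1, ρ) g) hscri,
    integral_integral_swap
      (f := fun τ g => edge ρs τ / (1 - τ) * energy s u (τ, edge ρs τ) g) hedge,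
    integral_integral_swap (f := energyFlux (region ε ρs) s d u) hflux,
    ← integral_const_mul, ← integral_const_mul,
    ← integral_add (hscri.integral_prod_right.const_mul _)
      (hedge.integral_prod_right.const_mul _), ← integral_neg]
  refine integral_mono ((hscri.integral_prod_right.const_mul _).add
    (hedge.integral_prod_right.const_mul _)).neg hflux.integral_prod_right fun g => ?_
  exact (neg_boundary_integrals_le_integral_nullDeriv hε hε2 hρ hd (contDiffOn_energy hu g)
    fun z _ => energy_nonneg u z g).trans_eq
    (setIntegral_congr_fun hKc.measurableSet fun z hz =>
      nullDeriv_energy hK.uniqueDiffOn hu d hz g)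

theorem CoupledTransport.energy_inequality {x y : ℂ} {A B : ℝ} {a : ι → ℝ} {c e : ι → Field}
    (H : CoupledTransport (region ε ρs) s x y A B a u w c e)
    (hε : 0 < ε) (hε2 : ε < 2) (hρ : 0 < ρs) (hB : 0 ≤ B)
    (hu : ∀ i ∈ s, IsCk 1 (region ε ρs) (u i)) (hw : ∀ i ∈ s, IsCk 1 (region ε ρs) (w i)) :
    ∫ z in region ε ρs, ∫ g, energy s u z g ∂haarSU2
      ≤ energyConst s.card A B * (∫ z in region ε ρs, ∫ g, energy s w z g ∂haarSU2)
        + 2 * (∫ τ in Icc (-1) (-1 + ε),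
            edge ρs τ / (1 - τ) * ∫ g, energy s u (τ, edge ρs τ) g ∂haarSU2)
        + 2 * ∫ ρ in Icc 0 ρs, ∫ g, energy s w (-1, ρ) g ∂haarSU2 := by
  have hupper := H.setIntegral_energyFlux_add_le (regularRegion_region hε hε2 hρ)
    (isCompact_region hε2 hρ) hB hu hw
  have hincoming := neg_boundary_energies_le_integral_energyFlux hε hε2 hρ (d := 1) (by simp) hu
  have houtgoing := neg_boundary_energies_le_integral_energyFlux hε hε2 hρ (d := -1) (by simp) hw
  linarith

end EnergyInequality

/-! ### The norms as integrals of energies -/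

section Jet

variable {K : Set (ℝ × ℝ)} {f f' : Field} {m p q : ℕ} {x : ℕ × ℕ × (Fin 3 → ℕ)}

theorem FirstOrder.iterate_add_smul {A : Field → Field} (hA : FirstOrder K A) (c : ℂ) {a : ℕ}
    (hf : IsCk a K f) (hf' : IsCk a K f') :
    EqOn (A^[a] (f + c • f')) (A^[a] f + c • A^[a] f') K := fun _ hz =>
  (hA.iterate_add hf (hf'.const_smul c) hz).trans
    (congrArg (A^[a] f _ + ·) (hA.iterate_smul c hf' hz))

theorem Zpow_add_smul (c : ℂ) {α : Fin 3 → ℕ} (hf : IsCk (∑ l, α l) K f)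
    (hf' : IsCk (∑ l, α l) K f') :
    EqOn (Zpow α (f + c • f')) (Zpow α f + c • Zpow α f') K := fun z hz => by
  simp only [Pi.add_apply, Pi.smul_apply, Zpow_apply]
  rw [zMono_add (hf.fiber hz) ((hf'.fiber hz).smul c), zMono_smul]

/-- The derivatives `Z^α ∂_ρ^{p + p'} ∂_τ^{q + q'} f`, indexed by `x = (q', p', α)` as in `mho`. -/
noncomputable def jet (K : Set (ℝ × ℝ)) (p q : ℕ) (f : Field) (x : ℕ × ℕ × (Fin 3 → ℕ)) : Field :=
  Zpow x.2.2 ((dRho K)^[p + x.2.1] ((dTau K)^[q + x.1] f))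

theorem IsCk.jet (hK : RegularRegion K) (hf : IsCk (m + p + q + 1) K f) (hx : x ∈ mho m) :
    IsCk 1 K (jet K p q f x) := by
  rw [mem_mho] at hx
  exact isCk_Zpow hK (isCk_dRho_dTau hK (hf.of_le (by omega)))

theorem jet_add_smul (hK : RegularRegion K) (c : ℂ) (hf : IsCk (m + p + q + 1) K f)
    (hf' : IsCk (m + p + q + 1) K f') (hx : x ∈ mho m) :
    EqOn (jet K p q (f + c • f') x) (jet K p q f x + c • jet K p q f' x) K := by
  rw [mem_mho] at hx
  have hT := firstOrder_dTau hK
  have hR := firstOrder_dRho hK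
  have htime := hT.iterate_add_smul c (a := q + x.1) (hf.of_le (by omega)) (hf'.of_le (by omega))
  have hspace := hR.iterate_add_smul c (a := p + x.2.1)
    (hT.isCk_iterate (a := q + x.1) (hf.of_le (by omega)))
    (hT.isCk_iterate (a := q + x.1) (hf'.of_le (by omega)))
  have hgroup := Zpow_add_smul (α := x.2.2) c
    (isCk_dRho_dTau hK (P := p + x.2.1) (Q := q + x.1) (hf.of_le (by omega)))
    (isCk_dRho_dTau hK (P := p + x.2.1) (Q := q + x.1) (hf'.of_le (by omega)))
  exact (Zpow_congr ((hR.iterate_congr _ htime).trans hspace) _).trans hgroup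

theorem norm_add_mul_sq_le (a b c : ℂ) : ‖a + c * b‖ ^ 2 ≤ 2 * (‖a‖ ^ 2 + ‖c‖ ^ 2 * ‖b‖ ^ 2) := by
  calc ‖a + c * b‖ ^ 2 ≤ (‖a‖ + ‖c * b‖) ^ 2 := by gcongr; exact norm_add_le _ _
    _ ≤ 2 * (‖a‖ ^ 2 + ‖c * b‖ ^ 2) := add_sq_le
    _ = _ := by rw [norm_mul, mul_pow]

theorem energy_jet_add_smul_le (hK : RegularRegion K) (c : ℂ) (hf : IsCk (m + p + q + 1) K f)
    (hf' : IsCk (m + p + q + 1) K f') {z : ℝ × ℝ} (hz : z ∈ K) (g : SU2) :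
    energy (mho m) (jet K p q (f + c • f')) z g
      ≤ 2 * (energy (mho m) (jet K p q f) z g
        + ‖c‖ ^ 2 * energy (mho m) (jet K p q f') z g) := by
  simp only [energy, Finset.mul_sum, ← Finset.sum_add_distrib]
  refine Finset.sum_le_sum fun x hx => ?_
  rw [jet_add_smul hK c hf hf' hx hz]
  exact norm_add_mul_sq_le _ _ c

end Jet

section SetIntegral

variable {Y : Type*} [TopologicalSpace Y] [MeasurableSpace Y] [BorelSpace Y] [T2Space Y]
  [SecondCountableTopology Y] {μ : Measure Y} [IsFiniteMeasureOnCompacts μ] [SFinite μ]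
  {t : Set Y} {γ : Y → ℝ × ℝ} {K : Set (ℝ × ℝ)}

theorem integral_energy_jet_add_smul_le (hK : RegularRegion K) {m p q : ℕ} {f f' : Field} (c : ℂ)
    (hf : IsCk (m + p + q + 1) K f) (hf' : IsCk (m + p + q + 1) K f') (ht : IsCompact t)
    (hγ : ContinuousOn γ t) (hmaps : MapsTo γ t K) :
    ∫ y in t, ∫ g, energy (mho m) (jet K p q (f + c • f')) (γ y) g ∂haarSU2 ∂μ
      ≤ 2 * ((∫ y in t, ∫ g, energy (mho m) (jet K p q f) (γ y) g ∂haarSU2 ∂μ)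
        + ‖c‖ ^ 2 * ∫ y in t, ∫ g, energy (mho m) (jet K p q f') (γ y) g ∂haarSU2 ∂μ) := by
  have hfiber : ∀ {F : Field}, IsCk (m + p + q + 1) K F → ∀ y ∈ t,
      Integrable (energy (mho m) (jet K p q F) (γ y)) haarSU2 := fun hF _ hy =>
    integrable_haarSU2_of_continuous (continuous_energy (fun _ hx => hF.jet hK hx) (hmaps hy))
  have htotal : ∀ {F : Field}, IsCk (m + p + q + 1) K F →
      IntegrableOn (fun y => ∫ g, energy (mho m) (jet K p q F) (γ y) g ∂haarSU2) t μ := fun hF =>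
    (integrable_prod_haarSU2 ht
      (continuousOn_energy_comp (fun _ hx => hF.jet hK hx) hγ hmaps)).integral_prod_left
  rw [← integral_const_mul, ← integral_add (htotal hf) ((htotal hf').const_mul _),
    ← integral_const_mul]
  refine setIntegral_mono_on (htotal (hf.add (hf'.const_smul c)))
    (((htotal hf).add ((htotal hf').const_mul _)).const_mul 2) ht.measurableSet fun y hy => ?_
  rw [← integral_const_mul, ← integral_add (hfiber hf y hy) ((hfiber hf' y hy).const_mul _),
    ← integral_const_mul]
  exact integral_mono (hfiber (hf.add (hf'.const_smul c)) y hy)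
    (((hfiber hf y hy).add ((hfiber hf' y hy).const_mul _)).const_mul 2)
    fun g => energy_jet_add_smul_le hK c hf hf' (hmaps hy) g

theorem lintegral_enorm_sq_eq {h : SU2 → ℂ} (hh : Continuous h) :
    ∫⁻ g, ‖h g‖ₑ ^ 2 ∂haarSU2 = ENNReal.ofReal (∫ g, ‖h g‖ ^ 2 ∂haarSU2) := by
  have hint : Integrable (fun g => ‖h g‖ ^ 2) haarSU2 :=
    integrable_haarSU2_of_continuous (hh.norm.pow 2)
  rw [ofReal_integral_eq_lintegral_ofReal hint (Filter.Eventually.of_forall fun _ => sq_nonneg _)]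
  simp only [ENNReal.ofReal_pow (norm_nonneg _), ofReal_norm]

variable {ι : Type*} {s : Finset ι} {u F : ι → Field} {n : ℕ} {δ : Y → ℝ}

theorem integrableOn_mul_integral_norm_sq (ht : IsCompact t) (hγ : ContinuousOn γ t)
    (hmaps : MapsTo γ t K) (hδ : ContinuousOn δ t) {f : Field} (hf : IsCk n K f) :
    IntegrableOn (fun y => δ y * ∫ g, ‖f (γ y) g‖ ^ 2 ∂haarSU2) t μ := by
  have hδ' : ContinuousOn (fun x : Y × SU2 => δ x.1) (t ×ˢ Set.univ) :=
    hδ.comp continuousOn_fst fun _ hx => hx.1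
  have hf' : ContinuousOn (fun x : Y × SU2 => f (γ x.1) x.2) (t ×ˢ Set.univ) :=
    hf.continuousOn.comp (f := fun x : Y × SU2 => (γ x.1, x.2))
      ((hγ.comp continuousOn_fst fun _ hx => hx.1).prodMk continuousOn_snd)
      fun _ hx => mk_mem_prod (hmaps hx.1) (mem_univ _)
  have h := (integrable_prod_haarSU2 (μ := μ) ht (hδ'.mul (hf'.norm.pow 2))).integral_prod_left
  rw [IntegrableOn]
  simpa only [Pi.mul_apply, Pi.pow_apply, integral_const_mul] using h

theorem sum_setLIntegral_eq (ht : IsCompact t) (hγ : ContinuousOn γ t) (hmaps : MapsTo γ t K)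
    (hδ : ContinuousOn δ t) (hδ0 : ∀ y ∈ t, 0 ≤ δ y) (hu : ∀ i ∈ s, IsCk n K (u i))
    (hF : ∀ i ∈ s, EqOn (F i) (u i) K) :
    ∑ i ∈ s, ∫⁻ y in t, ENNReal.ofReal (δ y) * ∫⁻ g, ‖F i (γ y) g‖ₑ ^ 2 ∂haarSU2 ∂μ
      = ENNReal.ofReal (∫ y in t, δ y * ∫ g, energy s u (γ y) g ∂haarSU2 ∂μ) := by
  have hint : ∀ i ∈ s, IntegrableOn (fun y => δ y * ∫ g, ‖u i (γ y) g‖ ^ 2 ∂haarSU2) t μ :=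
    fun i hi => integrableOn_mul_integral_norm_sq ht hγ hmaps hδ (hu i hi)
  have hfiber : ∀ i ∈ s, ∀ y ∈ t, Integrable (fun g => ‖u i (γ y) g‖ ^ 2) haarSU2 :=
    fun i hi y hy => integrable_haarSU2_of_continuous
      (((hu i hi).continuous_fiber (hmaps hy)).norm.pow 2)
  have hnonneg : ∀ i, ∀ y ∈ t, 0 ≤ δ y * ∫ g, ‖u i (γ y) g‖ ^ 2 ∂haarSU2 := fun i y hy =>
    mul_nonneg (hδ0 y hy) (integral_nonneg fun _ => sq_nonneg _)
  calc ∑ i ∈ s, ∫⁻ y in t, ENNReal.ofReal (δ y) * ∫⁻ g, ‖F i (γ y) g‖ₑ ^ 2 ∂haarSU2 ∂μ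
      = ∑ i ∈ s, ENNReal.ofReal (∫ y in t, δ y * ∫ g, ‖u i (γ y) g‖ ^ 2 ∂haarSU2 ∂μ) := by
        refine Finset.sum_congr rfl fun i hi => ?_
        rw [ofReal_integral_eq_lintegral_ofReal (hint i hi)
          (ae_restrict_of_forall_mem ht.measurableSet (hnonneg i))]
        refine setLIntegral_congr_fun ht.measurableSet fun y hy => ?_
        rw [hF i hi (hmaps hy), lintegral_enorm_sq_eq ((hu i hi).continuous_fiber (hmaps hy)),
          ENNReal.ofReal_mul (hδ0 y hy)]
    _ = ENNReal.ofReal (∑ i ∈ s, ∫ y in t, δ y * ∫ g, ‖u i (γ y) g‖ ^ 2 ∂haarSU2 ∂μ) :=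
        (ENNReal.ofReal_sum_of_nonneg fun i _ =>
          setIntegral_nonneg ht.measurableSet (hnonneg i)).symm
    _ = ENNReal.ofReal (∫ y in t, δ y * ∫ g, energy s u (γ y) g ∂haarSU2 ∂μ) := by
        rw [← integral_finsetSum _ hint]
        refine congrArg _ (setIntegral_congr_fun ht.measurableSet fun y hy => ?_)
        simp only [energy]
        rw [← Finset.mul_sum, integral_finsetSum _ fun i hi => hfiber i hi y hy]

end SetIntegral

section Norms

variable {ε ρs Ω : ℝ} {f : Field} {m p q : ℕ}

theorem sobolevSq_le_iff (hε : 0 < ε) (hε2 : ε < 2) (hρ : 0 < ρs) (hΩ : 0 ≤ Ω)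
    (hf : IsCk (m + p + q + 1) (region ε ρs) f) :
    sobolevSq ε ρs m ((dRho (region ε ρs))^[p] ((dTau (region ε ρs))^[q] f)) ≤ ENNReal.ofReal Ω ↔
      ∫ z in region ε ρs, ∫ g, energy (mho m) (jet (region ε ρs) p q f) z g ∂haarSU2 ≤ Ω := by
  have hK := regularRegion_region hε hε2 hρ
  have h := sum_setLIntegral_eq (μ := volume) (s := mho m) (isCompact_region hε2 hρ)
    (γ := fun z => z) continuousOn_id (mapsTo_id _) (δ := fun _ => 1) continuousOn_const
    (fun _ _ => zero_le_one) (fun x hx => hf.jet hK hx)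
    (fun x hx => D_dRho_dTau hK (hf.of_le (by rw [mem_mho] at hx; omega)))
  simp only [ENNReal.ofReal_one, one_mul] at h
  rw [sobolevSq, h, ENNReal.ofReal_le_ofReal_iff hΩ]

theorem scriDataSq_le_iff (hε : 0 < ε) (hε2 : ε < 2) (hρ : 0 < ρs) (hΩ : 0 ≤ Ω)
    (hf : IsCk (m + p + q + 1) (region ε ρs) f) :
    scriDataSq ε ρs m ((dTau (region ε ρs))^[q] ((dRho (region ε ρs))^[p] f))
        ≤ ENNReal.ofReal Ω ↔
      ∫ ρ in Icc 0 ρs, ∫ g, energy (mho m) (jet (region ε ρs) p q f) (-1, ρ) g ∂haarSU2 ≤ Ω := by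
  have hK := regularRegion_region hε hε2 hρ
  have h := sum_setLIntegral_eq (μ := volume) (s := mho m) (isCompact_Icc (a := 0) (b := ρs))
    (γ := fun ρ => ((-1 : ℝ), ρ)) (by fun_prop) (mapsTo_scri hε) (δ := fun _ => 1)
    continuousOn_const (fun _ _ => zero_le_one) (fun x hx => hf.jet hK hx)
    (fun x hx => D_dTau_dRho hK (hf.of_le (by rw [mem_mho] at hx; omega)))
  simp only [ENNReal.ofReal_one, one_mul] at h
  rw [scriDataSq, h, ENNReal.ofReal_le_ofReal_iff hΩ]

theorem edgeDensity_eq_mul_div (ρs τ : ℝ) :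
    edgeDensity ρs τ = Real.sqrt 2 * (edge ρs τ / (1 - τ)) :=
  mul_div_assoc _ _ _

theorem edgeDataSq_le_iff (hε : 0 < ε) (hε2 : ε < 2) (hρ : 0 < ρs) (hΩ : 0 ≤ Ω)
    (hf : IsCk (m + p + q + 1) (region ε ρs) f) :
    edgeDataSq ε ρs m ((dTau (region ε ρs))^[q] ((dRho (region ε ρs))^[p] f))
        ≤ ENNReal.ofReal Ω ↔
      Real.sqrt 2 * (∫ τ in Icc (-1) (-1 + ε), edge ρs τ / (1 - τ) *
        ∫ g, energy (mho m) (jet (region ε ρs) p q f) (τ, edge ρs τ) g ∂haarSU2) ≤ Ω := by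
  have hK := regularRegion_region hε hε2 hρ
  have hδ : ContinuousOn (edgeDensity ρs) (Icc (-1) (-1 + ε)) :=
    (continuousOn_const.mul ((continuousOn_edge_div ρs).mono (Icc_subset_Iio_one hε2))).congr
      fun τ _ => edgeDensity_eq_mul_div ρs τ
  have hδ0 : ∀ τ ∈ Icc (-1) (-1 + ε), 0 ≤ edgeDensity ρs τ := fun τ hτ => by
    have hτ1 : τ < 1 := Icc_subset_Iio_one hε2 hτ
    exact div_nonneg (mul_nonneg (Real.sqrt_nonneg _) (edge_pos hρ hτ1).le) (by linarith)
  have h := sum_setLIntegral_eq (μ := volume) (s := mho m) isCompact_Icc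
    (continuousOn_edge_curve (ρs := ρs) hε2) (mapsTo_edge hε2 hρ) hδ hδ0
    (fun x hx => hf.jet hK hx)
    (fun x hx => D_dTau_dRho hK (hf.of_le (by rw [mem_mho] at hx; omega)))
  rw [edgeDataSq, h, ENNReal.ofReal_le_ofReal_iff hΩ]
  simp only [edgeDensity_eq_mul_div, mul_assoc, integral_const_mul]

end Norms

/-! ### The commuted transport equations -/

section Commuted

variable {K : Set (ℝ × ℝ)} {m p q : ℕ} {x : ℕ × ℕ × (Fin 3 → ℕ)} {u w f : Field}

/-- The commutator of `Z^α` with the angular operator `a Z₂ + b Z₁`, applied to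
`∂_ρ^{p + p'} ∂_τ^{q + q'} f`, where `x = (q', p', α)`. -/
noncomputable def jetCommutator (K : Set (ℝ × ℝ)) (p q : ℕ) (a b : ℂ) (f : Field)
    (x : ℕ × ℕ × (Fin 3 → ℕ)) : Field := fun z =>
  zMono x.2.2 (xOp a b ((dRho K)^[p + x.2.1] ((dTau K)^[q + x.1] f) z))
    - xOp a b (zMono x.2.2 ((dRho K)^[p + x.2.1] ((dTau K)^[q + x.1] f) z))

theorem xField_jet_add_jetCommutator (a b : ℂ) (f : Field) :
    xField a b (jet K p q f x) + jetCommutator K p q a b f x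
      = Zpow x.2.2 (xField a b ((dRho K)^[p + x.2.1] ((dTau K)^[q + x.1] f))) := by
  funext z g
  simp only [Pi.add_apply, Pi.sub_apply, xField_apply, jetCommutator, jet, Zpow_apply,
    add_sub_cancel]

theorem Transports.jet (hK : RegularRegion K) {c d e a : ℝ} {b b' : ℂ}
    (hu : IsCk (m + p + q + 1) K u) (hw : IsCk (m + p + q + 1) K w)
    (H : Transports K c d e a u (xField b b' w)) (hx : x ∈ mho m) :
    Transports K c d e (a + (q + x.1 : ℕ) * d + (p + x.2.1 : ℕ) * e) (jet K p q u x)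
      (xField b b' (LowerDomain.jet K p q w x) + jetCommutator K p q b b' w x) := by
  rw [mem_mho] at hx
  rw [xField_jet_add_jetCommutator]
  exact H.commute hK (hu.of_le (by omega)) (hw.of_le (by omega))

theorem sum_multiIndices_le_energy_jet (f : Field) (hx : x ∈ mho m) (z : ℝ × ℝ) (g : SU2) :
    ∑ β ∈ multiIndices (∑ l, x.2.2 l),
        ‖zMono β ((dRho K)^[p + x.2.1] ((dTau K)^[q + x.1] f) z) g‖ ^ 2
      ≤ energy (mho m) (jet K p q f) z g := by
  have hinj : Function.Injective fun β : Fin 3 → ℕ => (x.1, x.2.1, β) := fun β β' h => by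
    simpa using h
  have hsub : (multiIndices (∑ l, x.2.2 l)).map ⟨_, hinj⟩ ⊆ mho m := by
    intro y hy
    obtain ⟨β, hβ, rfl⟩ := Finset.mem_map.mp hy
    rw [mem_multiIndices] at hβ
    rw [mem_mho] at hx ⊢
    simp only [Function.Embedding.coeFn_mk]
    omega
  refine le_trans (le_of_eq ?_) (Finset.sum_le_sum_of_subset_of_nonneg hsub
    fun _ _ _ => sq_nonneg _)
  simp only [Finset.sum_map, Function.Embedding.coeFn_mk, jet, Zpow_apply]

theorem exists_jetCommutator_bound (a b : ℂ) (m : ℕ) : ∃ B : ℝ, 0 ≤ B ∧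
    ∀ ⦃K : Set (ℝ × ℝ)⦄ ⦃p q : ℕ⦄ ⦃f : Field⦄, RegularRegion K → IsCk (m + p + q + 1) K f →
      ∀ x ∈ mho m, ∀ z ∈ K, ∀ g,
        ‖jetCommutator K p q a b f x z g‖ ^ 2 ≤ B * energy (mho m) (jet K p q f) z g := by
  choose C hC0 hC using exists_zMono_xOp_commutator_bound a b
  refine ⟨∑ α ∈ multiIndices m, C α, Finset.sum_nonneg fun α _ => hC0 α, ?_⟩
  intro K p q f hK hf x hx z hz g
  have hx' := mem_mho.mp hx
  have hreg : IsCk (∑ l, x.2.2 l + 1) K ((dRho K)^[p + x.2.1] ((dTau K)^[q + x.1] f)) :=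
    isCk_dRho_dTau hK (hf.of_le (by omega))
  refine (hC x.2.2 _ (hreg.fiber hz) g).trans ?_
  gcongr
  · exact Finset.sum_nonneg fun α _ => hC0 α
  · exact Finset.single_le_sum (f := C) (fun β _ => hC0 β) (mem_multiIndices.mpr (by omega))
  · exact sum_multiIndices_le_energy_jet f hx z g

-- This is where `m + p < q` enters: each `∂_τ` raises the coefficient of `u` by one and each
-- `∂_ρ` lowers it by one.
theorem one_le_jet_coefficient (hmpq : m + p < q) (hx : x ∈ mho m) :
    (1 : ℝ) ≤ (q + x.1 : ℕ) - (p + x.2.1 : ℕ) ∧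
      ((q + x.1 : ℕ) : ℝ) - (p + x.2.1 : ℕ) ≤ (q + m : ℕ) := by
  rw [mem_mho] at hx
  have hlower : ((p + x.2.1 + 1 : ℕ) : ℝ) ≤ (q + x.1 : ℕ) := by
    exact_mod_cast (show p + x.2.1 + 1 ≤ q + x.1 by omega)
  have hupper : ((q + x.1 : ℕ) : ℝ) ≤ (q + m : ℕ) := by
    exact_mod_cast (show q + x.1 ≤ q + m by omega)
  have hnonneg : (0 : ℝ) ≤ (p + x.2.1 : ℕ) := Nat.cast_nonneg _
  push_cast at hlower hupper hnonneg ⊢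
  constructor <;> linarith

theorem exists_coupledTransport_jet (a b : ℂ) (hmpq : m + p < q) : ∃ B : ℝ, 0 ≤ B ∧
    ∀ ⦃K : Set (ℝ × ℝ)⦄ ⦃u w : Field⦄, RegularRegion K →
      IsCk (m + p + q + 1) K u → IsCk (m + p + q + 1) K w →
      Transports K 1 1 (-1) 0 u (xField a b w) →
      Transports K 1 (-1) 1 (-1) w (xField (starRingEnd ℂ a) (starRingEnd ℂ b) u) →
      CoupledTransport K (mho m) a b (q + m : ℕ) B
        (fun x => (q + x.1 : ℕ) - (p + x.2.1 : ℕ)) (jet K p q u) (jet K p q w)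
        (jetCommutator K p q a b w)
        (jetCommutator K p q (starRingEnd ℂ a) (starRingEnd ℂ b) u) := by
  obtain ⟨B₁, hB₁, hw_bound⟩ := exists_jetCommutator_bound a b m
  obtain ⟨B₂, hB₂, hu_bound⟩ :=
    exists_jetCommutator_bound (starRingEnd ℂ a) (starRingEnd ℂ b) m
  refine ⟨B₁ + B₂, add_nonneg hB₁ hB₂, fun K u w hK hu hw hincoming houtgoing => ?_⟩
  constructor
  · exact fun x hx => (one_le_jet_coefficient hmpq hx).1
  · exact fun x hx => (one_le_jet_coefficient hmpq hx).2
  · intro x hx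
    convert hincoming.jet hK hu hw hx using 1
    ring
  · intro x hx
    convert houtgoing.jet hK hw hu hx using 1
    ring
  · intro x hx z hz g
    exact (hw_bound hK hw x hx z hz g).trans
      (mul_le_mul_of_nonneg_right (le_add_of_nonneg_right hB₂) (energy_nonneg _ _ _))
  · intro x hx z hz g
    exact (hu_bound hK hu x hx z hz g).trans
      (mul_le_mul_of_nonneg_right (le_add_of_nonneg_left hB₁) (energy_nonneg _ _ _))

theorem exists_energy_jet_inequality (a b : ℂ) (hmpq : m + p < q) : ∃ C : ℝ, 0 ≤ C ∧
    ∀ ⦃ε ρs : ℝ⦄ ⦃u w : Field⦄, 0 < ε → ε < 2 → 0 < ρs →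
      IsCk (m + p + q + 1) (region ε ρs) u → IsCk (m + p + q + 1) (region ε ρs) w →
      Transports (region ε ρs) 1 1 (-1) 0 u (xField a b w) →
      Transports (region ε ρs) 1 (-1) 1 (-1) w
        (xField (starRingEnd ℂ a) (starRingEnd ℂ b) u) →
      ∫ z in region ε ρs, ∫ g, energy (mho m) (jet (region ε ρs) p q u) z g ∂haarSU2
        ≤ C * (∫ z in region ε ρs, ∫ g, energy (mho m) (jet (region ε ρs) p q w) z g ∂haarSU2)
          + 2 * (∫ τ in Icc (-1) (-1 + ε), edge ρs τ / (1 - τ) *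
              ∫ g, energy (mho m) (jet (region ε ρs) p q u) (τ, edge ρs τ) g ∂haarSU2)
          + 2 * ∫ ρ in Icc 0 ρs,
              ∫ g, energy (mho m) (jet (region ε ρs) p q w) (-1, ρ) g ∂haarSU2 := by
  obtain ⟨B, hB, hcoupled⟩ := exists_coupledTransport_jet a b hmpq
  refine ⟨energyConst (mho m).card (q + m : ℕ) B, by rw [energyConst]; positivity, ?_⟩
  intro ε ρs u w hε hε2 hρ hu hw hincoming houtgoing
  have hK := regularRegion_region hε hε2 hρ
  exact (hcoupled hK hu hw hincoming houtgoing).energy_inequality hε hε2 hρ hB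
    (fun _ hx => hu.jet hK hx) fun _ hx => hw.jet hK hx

end Commuted

section System

variable {K : Set (ℝ × ℝ)} {ψ ψ₁ ψ₂ : Field}

theorem Xminus_eq_xField (f : Field) : Xminus f = xField (-1) Complex.I f := by
  funext z g
  simp only [Xminus, xField, Pi.add_apply, Pi.smul_apply, smul_eq_mul]
  ring

theorem Xplus_eq_xField (f : Field) : Xplus f = xField (-1) (-Complex.I) f := by
  funext z g
  simp only [Xplus, xField, Pi.add_apply, Pi.smul_apply, smul_eq_mul]
  ring

theorem FirstOrder.map_add_smul {A : Field → Field} (hA : FirstOrder K A) (c : ℂ)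
    {f f' : Field} (hf : IsCk 1 K f) (hf' : IsCk 1 K f') :
    EqOn (A (f + c • f')) (A f + c • A f') K :=
  hA.iterate_add_smul (a := 1) c hf hf'

theorem transports_incoming_of_equation (hK : RegularRegion K) (hψ : IsCk 1 K ψ)
    (hψ₁ : IsCk 1 K ψ₁)
    (h : ∀ τ ρ : ℝ, (τ, ρ) ∈ K → ∀ g : SU2,
      (1 + τ) * dTau K ψ₂ (τ, ρ) g - ρ * dRho K ψ₂ (τ, ρ) g
        - 1 / 2 * Xminus ψ (τ, ρ) g - Xminus ψ₁ (τ, ρ) g = 0) :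
    Transports K 1 1 (-1) 0 ψ₂ (xField (-1) Complex.I (ψ₁ + (1 / 2 : ℂ) • ψ)) := fun z hz => by
  funext g
  have heq := h z.1 z.2 hz g
  rw [Xminus_eq_xField, Xminus_eq_xField] at heq
  rw [(firstOrder_xField hK (-1) Complex.I).map_add_smul (1 / 2) hψ₁ hψ hz]
  simp only [transport, Pi.add_apply, Pi.smul_apply, Complex.real_smul, smul_eq_mul]
  push_cast
  linear_combination heq

theorem transports_outgoing_of_equation (hK : RegularRegion K) (hψ : IsCk 1 K ψ)
    (hψ₁ : IsCk 1 K ψ₁)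
    (h : ∀ τ ρ : ℝ, (τ, ρ) ∈ K → ∀ g : SU2,
      (1 - τ) * dTau K ψ₁ (τ, ρ) g + ρ * dRho K ψ₁ (τ, ρ) g
        + 1 / 2 * ((1 - τ) * dTau K ψ (τ, ρ) g + ρ * dRho K ψ (τ, ρ) g)
        - Xplus ψ₂ (τ, ρ) g - 1 / 2 * ψ (τ, ρ) g - ψ₁ (τ, ρ) g = 0) :
    Transports K 1 (-1) 1 (-1) (ψ₁ + (1 / 2 : ℂ) • ψ) (xField (-1) (-Complex.I) ψ₂) :=
  fun z hz => by
  funext g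
  have heq := h z.1 z.2 hz g
  rw [Xplus_eq_xField] at heq
  simp only [transport, Pi.add_apply, Pi.smul_apply]
  rw [(firstOrder_dTau hK).map_add_smul (1 / 2) hψ₁ hψ hz,
    (firstOrder_dRho hK).map_add_smul (1 / 2) hψ₁ hψ hz]
  simp only [Pi.add_apply, Pi.smul_apply, Complex.real_smul, smul_eq_mul]
  push_cast
  linear_combination heq

end System

section Data

variable {ε ρs Ω : ℝ} {f f' : Field} {m p q : ℕ}

theorem integral_scri_energy_jet_add_half_le (hε : 0 < ε) (hε2 : ε < 2) (hρ : 0 < ρs)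
    (hΩ : 0 ≤ Ω) (hf : IsCk (m + p + q + 1) (region ε ρs) f)
    (hf' : IsCk (m + p + q + 1) (region ε ρs) f')
    (h : scriDataSq ε ρs m ((dTau (region ε ρs))^[q] ((dRho (region ε ρs))^[p] f))
      ≤ ENNReal.ofReal Ω)
    (h' : scriDataSq ε ρs m ((dTau (region ε ρs))^[q] ((dRho (region ε ρs))^[p] f'))
      ≤ ENNReal.ofReal Ω) :
    ∫ ρ in Icc 0 ρs, ∫ g,
      energy (mho m) (jet (region ε ρs) p q (f + (1 / 2 : ℂ) • f')) (-1, ρ) g ∂haarSU2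
        ≤ 5 / 2 * Ω := by
  rw [scriDataSq_le_iff hε hε2 hρ hΩ hf] at h
  rw [scriDataSq_le_iff hε hε2 hρ hΩ hf'] at h'
  have hadd := integral_energy_jet_add_smul_le (μ := volume) (regularRegion_region hε hε2 hρ)
    (1 / 2) hf hf' (isCompact_Icc (a := 0) (b := ρs)) (γ := fun ρ => ((-1 : ℝ), ρ))
    (by fun_prop) (mapsTo_scri hε)
  norm_num at hadd ⊢
  linarith

theorem integral_energy_jet_add_half_le (hε : 0 < ε) (hε2 : ε < 2) (hρ : 0 < ρs)
    (hΩ : 0 ≤ Ω) (hf : IsCk (m + p + q + 1) (region ε ρs) f)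
    (hf' : IsCk (m + p + q + 1) (region ε ρs) f')
    (h : sobolevSq ε ρs m ((dRho (region ε ρs))^[p] ((dTau (region ε ρs))^[q] f))
      ≤ ENNReal.ofReal Ω)
    (h' : sobolevSq ε ρs m ((dRho (region ε ρs))^[p] ((dTau (region ε ρs))^[q] f'))
      ≤ ENNReal.ofReal Ω) :
    ∫ z in region ε ρs, ∫ g,
      energy (mho m) (jet (region ε ρs) p q (f + (1 / 2 : ℂ) • f')) z g ∂haarSU2
        ≤ 5 / 2 * Ω := by
  rw [sobolevSq_le_iff hε hε2 hρ hΩ hf] at h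
  rw [sobolevSq_le_iff hε hε2 hρ hΩ hf'] at h'
  have hadd := integral_energy_jet_add_smul_le (μ := volume) (regularRegion_region hε hε2 hρ)
    (1 / 2) hf hf' (isCompact_region hε2 hρ) (γ := fun z => z) continuousOn_id (mapsTo_id _)
  norm_num at hadd ⊢
  linarith

theorem integral_edge_energy_jet_le (hε : 0 < ε) (hε2 : ε < 2) (hρ : 0 < ρs) (hΩ : 0 ≤ Ω)
    (hf : IsCk (m + p + q + 1) (region ε ρs) f)
    (h : edgeDataSq ε ρs m ((dTau (region ε ρs))^[q] ((dRho (region ε ρs))^[p] f))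
      ≤ ENNReal.ofReal Ω) :
    ∫ τ in Icc (-1) (-1 + ε), edge ρs τ / (1 - τ) *
      ∫ g, energy (mho m) (jet (region ε ρs) p q f) (τ, edge ρs τ) g ∂haarSU2 ≤ Ω := by
  rw [edgeDataSq_le_iff hε hε2 hρ hΩ hf, mul_comm] at h
  have hsqrt : 1 ≤ Real.sqrt 2 := Real.one_le_sqrt.mpr one_le_two
  exact (le_div_iff₀ (by positivity)).mpr h |>.trans (div_le_self hΩ hsqrt)

end Data

end LowerDomain

theorem proposition2_general (m p q : ℕ) (hmpq : m + p < q) :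
    ∃ C : ℝ, 0 < C ∧
      ∀ ε ρs Ω : ℝ, 0 < ε → ε < 2 → 0 < ρs → 0 < Ω →
      ∀ ψ ψ₁ ψ₂ : Field,
        (∀ f ∈ ({ψ, ψ₁, ψ₂} : Set Field), IsCk (m + p + q + 1) (region ε ρs) f) →
        (∀ τ ρ : ℝ, (τ, ρ) ∈ region ε ρs → ∀ g : SU2,
          (1 + τ) * dTau (region ε ρs) ψ₂ (τ, ρ) g - ρ * dRho (region ε ρs) ψ₂ (τ, ρ) g
            - 1 / 2 * Xminus ψ (τ, ρ) g - Xminus ψ₁ (τ, ρ) g = 0) →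
        (∀ τ ρ : ℝ, (τ, ρ) ∈ region ε ρs → ∀ g : SU2,
          (1 - τ) * dTau (region ε ρs) ψ₁ (τ, ρ) g + ρ * dRho (region ε ρs) ψ₁ (τ, ρ) g
            + 1 / 2 * ((1 - τ) * dTau (region ε ρs) ψ (τ, ρ) g
              + ρ * dRho (region ε ρs) ψ (τ, ρ) g)
            - Xplus ψ₂ (τ, ρ) g - 1 / 2 * ψ (τ, ρ) g - ψ₁ (τ, ρ) g = 0) →
        edgeDataSq ε ρs m ((dTau (region ε ρs))^[q] ((dRho (region ε ρs))^[p] ψ₂))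
          ≤ ENNReal.ofReal Ω →
        (∀ f ∈ ({ψ, ψ₁} : Set Field),
          scriDataSq ε ρs m ((dTau (region ε ρs))^[q] ((dRho (region ε ρs))^[p] f))
              ≤ ENNReal.ofReal Ω ∧
            sobolevSq ε ρs m ((dRho (region ε ρs))^[p] ((dTau (region ε ρs))^[q] f))
              ≤ ENNReal.ofReal Ω) →
        sobolevSq ε ρs m ((dRho (region ε ρs))^[p] ((dTau (region ε ρs))^[q] ψ₂))
          ≤ ENNReal.ofReal (C * Ω) := by
  obtain ⟨C, hC, henergy⟩ := exists_energy_jet_inequality (-1) Complex.I hmpq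
  refine ⟨5 / 2 * C + 7, by positivity, ?_⟩
  intro ε ρs Ω hε hε2 hρ hΩ ψ ψ₁ ψ₂ hreg hA hB hedge hdata
  have hK := regularRegion_region hε hε2 hρ
  simp only [mem_insert_iff, mem_singleton_iff, forall_eq_or_imp, forall_eq] at hreg hdata
  obtain ⟨hψ, hψ₁, hψ₂⟩ := hreg
  obtain ⟨⟨hscri, hbulk⟩, hscri₁, hbulk₁⟩ := hdata
  have hincoming := transports_incoming_of_equation hK (hψ.of_le (by omega))
    (hψ₁.of_le (by omega)) hA
  have houtgoing := transports_outgoing_of_equation hK (hψ.of_le (by omega))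
    (hψ₁.of_le (by omega)) hB
  have hmain := henergy hε hε2 hρ hψ₂ (hψ₁.add (hψ.const_smul (1 / 2))) hincoming
    (by simpa only [map_neg, map_one, Complex.conj_I] using houtgoing)
  have hscri_le := integral_scri_energy_jet_add_half_le hε hε2 hρ hΩ.le hψ₁ hψ hscri₁ hscri
  have hbulk_le := integral_energy_jet_add_half_le hε hε2 hρ hΩ.le hψ₁ hψ hbulk₁ hbulk
  have hedge_le := integral_edge_energy_jet_le hε hε2 hρ hΩ.le hψ₂ hedge
  rw [sobolevSq_le_iff hε hε2 hρ (by positivity) hψ₂]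
  linarith [mul_le_mul_of_nonneg_left hbulk_le hC]

theorem proposition2 (m p q : ℕ) (hmpq : m + p < q) :
    ∃ C : ℝ, 0 < C ∧
      ∀ ε ρs Ω : ℝ, 0 < ε → ε < 2 → 0 < ρs → 0 < Ω →
      ∀ ψ ψ₀ ψ₁ ψ₂ : Field,
        (∀ f ∈ ({ψ, ψ₀, ψ₁, ψ₂} : Set Field), IsCk (m + p + q + 1) (region ε ρs) f) →
        SolvesTransport (region ε ρs) ψ ψ₀ ψ₁ ψ₂ →
        (∀ f ∈ ({ψ, ψ₀, ψ₁, ψ₂} : Set Field),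
          scriDataSq ε ρs m ((dTau (region ε ρs))^[q] ((dRho (region ε ρs))^[p] f))
            + edgeDataSq ε ρs m ((dTau (region ε ρs))^[q] ((dRho (region ε ρs))^[p] f))
            ≤ ENNReal.ofReal Ω) →
        (∀ g ∈ ({ψ, ψ₀, ψ₁} : Set Field),
          sobolevSq ε ρs m ((dRho (region ε ρs))^[p] ((dTau (region ε ρs))^[q] g))
            ≤ ENNReal.ofReal Ω) →
        sobolevSq ε ρs m ((dRho (region ε ρs))^[p] ((dTau (region ε ρs))^[q] ψ₂))
          ≤ ENNReal.ofReal (C * Ω) := by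
  obtain ⟨C, hC, h⟩ := proposition2_general m p q hmpq
  refine ⟨C, hC, fun ε ρs Ω hε hε2 hρ hΩ ψ ψ₀ ψ₁ ψ₂ hreg hsol hdata hnorm => ?_⟩
  exact h ε ρs Ω hε hε2 hρ hΩ ψ ψ₁ ψ₂ (fun f hf => hreg f (by grind)) hsol.A₀ hsol.B₀
    (le_add_self.trans (hdata ψ₂ (by simp)))
    fun f hf => ⟨le_self_add.trans (hdata f (by grind)), hnorm f (by grind)⟩
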